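/- Let $N\ge 1$ be an integer, $0<\alpha<1$, $\lambda\in\mathbb C\setminus\{0\}$ and $s>3+\frac N2+\alpha$. Then there exists an initial value $\varphi\in C_c^\infty(\mathbb R^N)$ (complex-valued) such that there is no $T>0$ for which the Cauchy problem $$\begin{cases} i u_t=\Delta u+\lambda |u|^\alpha u,\\ u(0,\cdot)=\varphi(\cdot)\end{cases}$$ in $\mathbb R^N$ has a solution $u\in C([0,T],H^s(\mathbb R^N))$, where the equation is understood in the sense of distributions on $(0,T)\times\mathbb R^N$. -/

import Mathlib

open MeasureTheory
open scoped ContDiff SchwartzMap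

namespace NLS

/-- `ℝ^N` with its Euclidean structure. -/
abbrev Space (N : ℕ) : Type := EuclideanSpace ℝ (Fin N)

/-- Complex-valued (classes of) functions in `L²(ℝ^N)`. -/
abbrev L2 (N : ℕ) : Type := Lp ℂ 2 (volume : Measure (Space N))

/-- `u ∈ C([0,T], H^s(ℝ^N))`, for a curve `u` in `L²(ℝ^N)` and `s ≥ 0`.
With Mathlib's Bessel potential operator `J_s`, the Fourier multiplier of symbol
`(1 + |ξ|²)^(s/2)`, the space `H^s` is the set of `f` such that `J_s f ∈ L²`, and
`‖J_s f‖_{L²}` is its norm (up to equivalence, this does not depend on the normalisation of the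
Fourier transform). So `u` is continuous with values in `H^s` on `[0,T]` if and only if
`t ↦ J_s (u t)` is a continuous curve in `L²` on `[0,T]`. -/
def ContinuousInSobolev (N : ℕ) (s T : ℝ) (u : ℝ → L2 N) : Prop :=
  ∃ v : ℝ → L2 N, ContinuousOn v (Set.Icc 0 T) ∧
    ∀ t ∈ Set.Icc 0 T,
      TemperedDistribution.besselPotential (Space N) ℂ s (u t : 𝓢'(Space N, ℂ)) =
        (v t : 𝓢'(Space N, ℂ))

/-- `i u_t = Δu + λ |u|^α u` in the sense of distributions on `(0,T) × ℝ^N`: after moving the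
derivatives to the test function `ψ ∈ C_c^∞((0,T) × ℝ^N)`,
`∫∫ (-i u ψ_t) dx dt = ∫∫ (u Δψ + λ |u|^α u ψ) dx dt`. -/
def SolvesEquation (N : ℕ) (α : ℝ) (lam : ℂ) (T : ℝ) (u : ℝ → L2 N) : Prop :=
  ∀ ψ : ℝ × Space N → ℂ, ContDiff ℝ ∞ ψ → HasCompactSupport ψ →
    tsupport ψ ⊆ Set.Ioo 0 T ×ˢ Set.univ →
    (∫ t in (0 : ℝ)..T, ∫ x : Space N, -Complex.I * u t x * deriv (fun τ => ψ (τ, x)) t) =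
      ∫ t in (0 : ℝ)..T, ∫ x : Space N,
        (u t x * Laplacian.laplacian (fun z : Space N => ψ (t, z)) x +
          lam * ((‖u t x‖ ^ α : ℝ) : ℂ) * u t x * ψ (t, x))

/-- `u ∈ C([0,T], H^s(ℝ^N))` is a solution on `[0,T]` of the Cauchy problem
`i u_t = Δu + λ |u|^α u`, `u(0) = φ`. Only the values of `u` on `[0,T]` matter. -/
structure IsSolution (N : ℕ) (α : ℝ) (lam : ℂ) (s T : ℝ) (φ : Space N → ℂ)
    (u : ℝ → L2 N) : Prop where
  continuous_sobolev : ContinuousInSobolev N s T u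
  equation : SolvesEquation N α lam T u
  initial : (u 0 : Space N → ℂ) =ᵐ[volume] φ

end NLS

/-! The obstruction is that `z ↦ λ|z|^α z` is no better than `C^(1+α)` at zero. Take `φ` odd,
smooth, compactly supported and equal to a coordinate near the origin. The equation preserves
oddness (`SolvesEquation.solMul_add_reflect_eq_zero`, an `L²` energy estimate), so a solution
satisfies `u(t,0) = 0`. For small `t` it stays close to the linear profile: `u(t,he) = h(1 +
small)`, uniformly in small `h`.

Compare second differences at `0, he, 2he` in the time-integrated pointwise equation
(`SolvesEquation.solEval_sub_eq`). Since `s > N/2 + 3 + α`, some `β > α` makes those of `u` and of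
`Δu` of order `h^(1+β)` (`norm_fourierEval_second_diff_le`). Those of the nonlinearity stay near
`λ(2^(1+α) - 2)h^(1+α)`, which is nonzero (`norm_second_diff_nonlin_sub_le`). Letting `h → 0` gives
the contradiction in `not_forall_solEval_sub_eq`.

Throughout, `u(t) = J_{-s} v(t)` with `v` a continuous curve in `L²`. Hence `u` and `Δu` are Fourier
multipliers applied to `v`, available both as `L²` classes and as bounded continuous functions, and
every pointwise bound reduces to a bound on symbols (`norm_sum_fourierEval_le`). -/

namespace NLS

open FourierTransform TemperedDistribution Filter Topology
open scoped ENNReal BoundedContinuousFunction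

/-! ### Fourier multipliers on `L²` and their continuous representatives -/

section

variable {N : ℕ}

/-- The `L²` Fourier multiplier with bounded symbol `m`. -/
noncomputable def fourierMul (m : Space N → ℂ) (hm : MemLp m ⊤ volume) : L2 N →L[ℂ] L2 N :=
  (fourierInvCLM ℂ (L2 N)) ∘L
    ((ContinuousLinearMap.lsmul ℂ ℂ).holderL volume ⊤ 2 2 (hm.toLp m)) ∘L (fourierCLM ℂ (L2 N))

/-- The Fourier multiplier with square-integrable symbol `m`, from `L²` to bounded continuous
functions. -/
noncomputable def fourierEval (m : Space N → ℂ) (hm : MemLp m 2 volume) :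
    L2 N →L[ℂ] (Space N →ᵇ ℂ) :=
  (Real.Lp.fourierTransformInvCLM (Space N) ℂ) ∘L
    ((ContinuousLinearMap.lsmul ℂ ℂ).holderL volume 2 2 1 (hm.toLp m)) ∘L (fourierCLM ℂ (L2 N))

theorem fourier_fourierMul_ae_eq (m : Space N → ℂ) (hm : MemLp m ⊤ volume) (f : L2 N) :
    (𝓕 (fourierMul m hm f) : L2 N) =ᵐ[volume] fun ξ => m ξ * (𝓕 f : L2 N) ξ := by
  have : (𝓕 (fourierMul m hm f) : L2 N) =
      (ContinuousLinearMap.lsmul ℂ ℂ).holder 2 (hm.toLp m) (𝓕 f : L2 N) := by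
    exact fourier_fourierInv_eq (E := L2 N) _
  rw [this]
  filter_upwards [(ContinuousLinearMap.lsmul ℂ ℂ).coeFn_holder (r := 2) (hm.toLp m) (𝓕 f : L2 N),
    hm.coeFn_toLp] with ξ h1 h2
  simp [h1, h2]

theorem integrable_mul_fourier (m : Space N → ℂ) (hm : MemLp m 2 volume) (f : L2 N) :
    Integrable (fun ξ => m ξ * (𝓕 f : L2 N) ξ) :=
  MemLp.integrable_mul hm (Lp.memLp _)

theorem fourierEval_apply (m : Space N → ℂ) (hm : MemLp m 2 volume) (f : L2 N) (x : Space N) :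
    fourierEval m hm f x = 𝓕⁻ (fun ξ => m ξ * (𝓕 f : L2 N) ξ) x := by
  have : fourierEval m hm f x = 𝓕⁻ (((ContinuousLinearMap.lsmul ℂ ℂ).holder 1 (hm.toLp m)
      (𝓕 f : L2 N) : Lp ℂ 1 (volume : Measure (Space N))) : Space N → ℂ) x := by
    simp only [fourierEval, ContinuousLinearMap.comp_apply, Real.Lp.fourierTransformInvCLM_apply,
      Real.Lp.fourierTransformInv_apply]
    rfl
  rw [this]
  apply Real.fourierInv_congr_ae
  filter_upwards [(ContinuousLinearMap.lsmul ℂ ℂ).coeFn_holder (r := 1) (hm.toLp m) (𝓕 f : L2 N),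
    hm.coeFn_toLp] with ξ h1 h2
  simp [h1, h2]

theorem toTemperedDistribution_injective {f g : L2 N} (h : (f : 𝓢'(Space N, ℂ)) = g) : f = g := by
  have := Lp.ker_toTemperedDistributionCLM_eq_bot (E := Space N) (F := ℂ) (μ := volume) (p := 2)
  rw [LinearMap.ker_eq_bot] at this
  exact this h

theorem fourierMul_toTemperedDistribution (m : Space N → ℂ) (hm : MemLp m ⊤ volume)
    (hg : m.HasTemperateGrowth) (f : L2 N) :
    (fourierMul m hm f : 𝓢'(Space N, ℂ)) = fourierMultiplierCLM ℂ m (f : 𝓢'(Space N, ℂ)) := by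
  rw [fourierMultiplierCLM_apply, Lp.fourier_toTemperedDistribution_eq,
    ← Lp.toTemperedDistribution_smul_eq (p := ⊤) (r := 2) hg hm,
    Lp.fourierInv_toTemperedDistribution_eq]
  rfl

/-- On `L¹ ∩ L²` the two inverse Fourier transforms agree. -/
theorem fourierInv_coeFn_ae_eq (f : L2 N) (hf : Integrable (f : Space N → ℂ)) :
    (𝓕⁻ f : L2 N) =ᵐ[volume] 𝓕⁻ (f : Space N → ℂ) := by
  have hcont : Continuous (𝓕⁻ (f : Space N → ℂ)) := by
    rw [← memLp_one_iff_integrable] at hf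
    rw [← Real.Lp.fourierTransformInv_toLp hf]
    exact BoundedContinuousFunction.continuous _
  apply ae_eq_of_integral_contDiff_smul_eq
  · exact (Lp.memLp _).locallyIntegrable (by norm_num)
  · exact hcont.locallyIntegrable
  intro g g_smooth g_cpt
  have hg₁ : HasCompactSupport (Complex.ofRealCLM ∘ g) := g_cpt.comp_left rfl
  have hg₂ : ContDiff ℝ ∞ (Complex.ofRealCLM ∘ g) := by fun_prop
  set G : 𝓢(Space N, ℂ) := hg₁.toSchwartzMap hg₂
  have h1 : ∫ x, g x • (𝓕⁻ f : L2 N) x = ((𝓕⁻ f : L2 N) : 𝓢'(Space N, ℂ)) G := by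
    simp [G]
  rw [h1, ← Lp.fourierInv_toTemperedDistribution_eq, TemperedDistribution.fourierInv_apply,
    Lp.toTemperedDistribution_apply]
  -- With the pairing `-innerₗ` the Fourier integral is the inverse transform, so the flip moves it
  -- from the test function to `f`.
  have key := VectorFourier.integral_fourierIntegral_smul_eq_flip (L := -innerₗ (Space N))
    (μ := volume) (ν := volume) (e := Real.fourierChar)
    (f := (G : Space N → ℂ)) (g := (f : Space N → ℂ)) Real.continuous_fourierChar
    (by simp only [LinearMap.neg_apply, innerₗ_apply_apply]; fun_prop) G.integrable hf
  calc _ = ∫ ξ, VectorFourier.fourierIntegral Real.fourierChar volume (-innerₗ (Space N)) G ξ • f ξ := by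
        congr with ξ
        rw [SchwartzMap.fourierInv_coe]
        simp [Real.fourierInv_eq, VectorFourier.fourierIntegral]
    _ = _ := by
        rw [key]
        congr with ξ
        simp [Real.fourierInv_eq, VectorFourier.fourierIntegral, G, real_inner_comm]

/-- The transform of the output is a product of two `L²` functions, hence in `L¹ ∩ L²`, where the
inversion formula holds pointwise. -/
theorem fourierMul_ae_eq_fourierEval (m : Space N → ℂ) (hm : MemLp m ⊤ volume)
    (hm2 : MemLp m 2 volume) (f : L2 N) :
    fourierMul m hm f =ᵐ[volume] fourierEval m hm2 f := by
  have h1 := fourier_fourierMul_ae_eq m hm f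
  have h2 := fourierInv_coeFn_ae_eq (𝓕 (fourierMul m hm f) : L2 N)
    ((integrable_mul_fourier m hm2 f).congr h1.symm)
  rw [fourierInv_fourier_eq] at h2
  refine h2.trans (Eventually.of_forall fun x => ?_)
  rw [fourierEval_apply]
  exact Real.fourierInv_congr_ae h1 x

/-- A linear combination of point values is controlled by a square-integrable majorant of its
symbol. -/
theorem norm_sum_fourierEval_le {ι : Type*} (I : Finset ι) (c : ι → ℂ) (p : ι → Space N)
    (m : Space N → ℂ) (hm : MemLp m 2 volume) (W : Space N → ℝ) (hW : MemLp W 2 volume) {A : ℝ}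
    (hA0 : 0 ≤ A)
    (hA : ∀ ξ, ‖∑ i ∈ I, c i * (Real.fourierChar (inner ℝ ξ (p i)) : ℂ)‖ * ‖m ξ‖ ≤ A * W ξ)
    (f : L2 N) :
    ‖∑ i ∈ I, c i * fourierEval m hm f (p i)‖ ≤ A * (‖hW.toLp W‖ * ‖f‖) := by
  set V : L2 N := 𝓕 f with hV
  have hint := integrable_mul_fourier m hm f
  have e1 : ∑ i ∈ I, c i * fourierEval m hm f (p i) =
      ∫ ξ, (∑ i ∈ I, c i * (Real.fourierChar (inner ℝ ξ (p i)) : ℂ)) * (m ξ * V ξ) := by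
    simp_rw [Finset.sum_mul]
    rw [integral_finsetSum]
    · refine Finset.sum_congr rfl fun i _ => ?_
      rw [fourierEval_apply, Real.fourierInv_eq, ← integral_const_mul]
      congr with ξ
      rw [Circle.smul_def, smul_eq_mul, mul_assoc]
    · intro i _
      simp_rw [mul_assoc]
      apply Integrable.const_mul
      have := (Real.fourierIntegral_convergent_iff (μ := volume) (-(p i))).2 hint
      refine this.congr (Eventually.of_forall fun ξ => ?_)
      simp only [inner_neg_right, neg_neg, Circle.smul_def, smul_eq_mul]
      rfl
  have hWV : Integrable (fun ξ => ‖W ξ‖ * ‖V ξ‖) :=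
    MemLp.integrable_mul hW.norm (Lp.memLp V).norm
  have e2 : ∫ ξ, ‖W ξ‖ * ‖V ξ‖ ≤ ‖hW.toLp W‖ * ‖V‖ := by
    refine le_trans (le_of_eq ?_) (Lp.norm_smul_le (r := 1) (hW.toLp W) V)
    rw [L1.norm_eq_integral_norm]
    apply integral_congr_ae
    filter_upwards [Lp.coeFn_lpSMul (r := 1) (hW.toLp W) V, hW.coeFn_toLp] with ξ h1 h2
    rw [h1, Pi.smul_apply', h2, norm_smul]
  have e3 : ‖V‖ = ‖f‖ := Lp.norm_fourier_eq f
  rw [e1, ← e3]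
  refine (norm_integral_le_integral_norm _).trans (le_trans ?_ (mul_le_mul_of_nonneg_left e2 hA0))
  rw [← integral_const_mul]
  refine integral_mono_of_nonneg (Eventually.of_forall fun ξ => norm_nonneg _)
    (hWV.const_mul A) (Eventually.of_forall fun ξ => ?_)
  simp only [norm_mul]
  calc _ = (‖∑ i ∈ I, c i * (Real.fourierChar (inner ℝ ξ (p i)) : ℂ)‖ * ‖m ξ‖) * ‖V ξ‖ := by ring
    _ ≤ A * W ξ * ‖V ξ‖ := mul_le_mul_of_nonneg_right (hA ξ) (norm_nonneg _)
    _ ≤ A * ‖W ξ‖ * ‖V ξ‖ := by gcongr; exact Real.le_norm_self _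
    _ = _ := by ring

end

/-! ### Bessel weights and finite differences at the origin -/

section

variable {N : ℕ}

/-- The Bessel weight `(1 + |ξ|²)^(-r/2)`. -/
noncomputable def weight (N : ℕ) (r : ℝ) (ξ : Space N) : ℝ := (1 + ‖ξ‖ ^ 2) ^ (-r / 2)

theorem weight_pos (r : ℝ) (ξ : Space N) : 0 < weight N r ξ := by
  unfold weight; positivity

theorem continuous_weight (r : ℝ) : Continuous (weight N r) := by
  unfold weight
  exact Continuous.rpow_const (by fun_prop) fun ξ => Or.inl (by positivity)

theorem weight_le_one {r : ℝ} (hr : 0 ≤ r) (ξ : Space N) : weight N r ξ ≤ 1 :=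
  Real.rpow_le_one_of_one_le_of_nonpos (by simp) (by linarith)

theorem weight_add (r r' : ℝ) (ξ : Space N) :
    weight N (r + r') ξ = weight N r ξ * weight N r' ξ := by
  unfold weight
  rw [← Real.rpow_add (by positivity)]
  ring_nf

/-- Since `|ξ|^b ≤ (1 + |ξ|²)^(b/2)`, each power of frequency costs one unit of decay. -/
theorem norm_rpow_mul_weight_le {b : ℝ} (hb : 0 ≤ b) (r : ℝ) (ξ : Space N) :
    ‖ξ‖ ^ b * weight N r ξ ≤ weight N (r - b) ξ := by
  have h : ‖ξ‖ ^ b ≤ weight N (-b) ξ := by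
    unfold weight
    rw [neg_neg]
    calc ‖ξ‖ ^ b = (‖ξ‖ ^ 2) ^ (b / 2) := by
          rw [← Real.rpow_natCast, ← Real.rpow_mul (norm_nonneg _)]; congr 1; push_cast; ring
      _ ≤ _ := by gcongr; linarith
  calc _ ≤ weight N (-b) ξ * weight N r ξ := by gcongr; exact (weight_pos _ _).le
    _ = _ := by rw [← weight_add]; ring_nf

/-- The square of the weight is `(1 + |ξ|²)^(-r)`, integrable when `2r > N`; every threshold
involving `N/2` comes from here. -/
theorem memLp_weight {r : ℝ} (hr : (N : ℝ) / 2 < r) : MemLp (weight N r) 2 volume := by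
  rw [memLp_two_iff_integrable_sq (continuous_weight r).aestronglyMeasurable]
  have := integrable_rpow_neg_one_add_norm_sq (E := Space N) (μ := volume) (r := 2 * r)
    (by simp; linarith)
  refine this.congr (Eventually.of_forall fun ξ => ?_)
  simp only [weight]
  rw [← Real.rpow_mul_natCast (by positivity)]
  congr 1; push_cast; ring

theorem memLp_top_of_norm_le_weight {m : Space N → ℂ} (hc : Continuous m) {C r : ℝ} (hr : 0 ≤ r)
    (hm : ∀ ξ, ‖m ξ‖ ≤ C * weight N r ξ) : MemLp m ⊤ volume := by
  have hC : 0 ≤ C := by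
    have := (norm_nonneg _).trans (hm 0)
    exact nonneg_of_mul_nonneg_left this (weight_pos _ _)
  exact memLp_top_of_bound hc.aestronglyMeasurable C (Eventually.of_forall fun ξ =>
    (hm ξ).trans (mul_le_of_le_one_right hC (weight_le_one hr ξ)))

theorem memLp_two_of_norm_le_weight {m : Space N → ℂ} (hc : Continuous m) {C r : ℝ}
    (hr : (N : ℝ) / 2 < r) (hm : ∀ ξ, ‖m ξ‖ ≤ C * weight N r ξ) : MemLp m 2 volume :=
  ((memLp_weight hr).const_mul C).mono' hc.aestronglyMeasurable (Eventually.of_forall hm)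

theorem norm_fourierChar_inner_sub_one_le (ξ p : Space N) :
    ‖(Real.fourierChar (inner ℝ ξ p) : ℂ) - 1‖ ≤ 2 * Real.pi * (‖ξ‖ * ‖p‖) := by
  rw [Real.fourierChar_apply]
  have := Real.norm_exp_I_mul_ofReal_sub_one_le (x := 2 * Real.pi * inner ℝ ξ p)
  rw [mul_comm] at this
  refine this.trans ?_
  rw [norm_mul, Real.norm_of_nonneg (by positivity)]
  gcongr
  exact norm_inner_le_norm _ _

/-- Lipschitz bound at the origin. -/
theorem norm_fourierEval_sub_le {m : Space N → ℂ} (hm : MemLp m 2 volume) {C r : ℝ}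
    (hC : 0 ≤ C) (hr : (N : ℝ) / 2 + 1 < r) (hmr : ∀ ξ, ‖m ξ‖ ≤ C * weight N r ξ) :
    ∃ K : ℝ, ∀ (p : Space N) (f : L2 N),
      ‖fourierEval m hm f p - fourierEval m hm f 0‖ ≤ K * ‖p‖ * ‖f‖ := by
  have hW : MemLp (weight N (r - 1)) 2 volume := memLp_weight (by linarith)
  refine ⟨2 * Real.pi * C * ‖hW.toLp _‖, fun p f => ?_⟩
  have := norm_sum_fourierEval_le Finset.univ ![1, -1] ![p, 0] m hm _ hW
    (A := 2 * Real.pi * C * ‖p‖) (by positivity) (fun ξ => ?_) f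
  · simp only [Fin.sum_univ_two, Matrix.cons_val_zero, Matrix.cons_val_one, one_mul, neg_mul,
      ← sub_eq_add_neg] at this
    exact this.trans_eq (by ring)
  · simp only [Fin.sum_univ_two, Matrix.cons_val_zero, Matrix.cons_val_one, one_mul, neg_mul,
      ← sub_eq_add_neg, inner_zero_right, AddChar.map_zero_eq_one, Circle.coe_one]
    calc _ ≤ 2 * Real.pi * (‖ξ‖ * ‖p‖) * (C * weight N r ξ) := by
          gcongr
          · exact norm_fourierChar_inner_sub_one_le ξ p
          · exact hmr ξ
      _ = 2 * Real.pi * C * ‖p‖ * (‖ξ‖ ^ (1 : ℝ) * weight N r ξ) := by rw [Real.rpow_one]; ring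
      _ ≤ _ := by gcongr; exact norm_rpow_mul_weight_le zero_le_one r ξ

/-- Second differences at the origin are `O(|p|^b)` for `0 ≤ b ≤ 2`. -/
theorem norm_fourierEval_second_diff_le {m : Space N → ℂ} (hm : MemLp m 2 volume) {C r b : ℝ}
    (hC : 0 ≤ C) (hb0 : 0 ≤ b) (hb2 : b ≤ 2) (hr : (N : ℝ) / 2 + b < r)
    (hmr : ∀ ξ, ‖m ξ‖ ≤ C * weight N r ξ) :
    ∃ K : ℝ, 0 ≤ K ∧ ∀ (p : Space N) (f : L2 N),
      ‖fourierEval m hm f ((2 : ℝ) • p) - 2 * fourierEval m hm f p + fourierEval m hm f 0‖ ≤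
        K * ‖p‖ ^ b * ‖f‖ := by
  have hW : MemLp (weight N (r - b)) 2 volume := memLp_weight (by linarith)
  refine ⟨4 * Real.pi ^ b * C * ‖hW.toLp _‖, by positivity, fun p f => ?_⟩
  have := norm_sum_fourierEval_le Finset.univ ![1, -2, 1] ![(2 : ℝ) • p, p, 0] m hm _ hW
    (A := 4 * Real.pi ^ b * C * ‖p‖ ^ b) (by positivity) (fun ξ => ?_) f
  · simp only [Fin.sum_univ_three, Matrix.cons_val_zero, Matrix.cons_val_one, Matrix.cons_val,
      one_mul, neg_mul, ← sub_eq_add_neg] at this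
    exact this.trans_eq (by ring)
  · simp only [Fin.sum_univ_three, Matrix.cons_val_zero, Matrix.cons_val_one, Matrix.cons_val,
      one_mul, neg_mul, ← sub_eq_add_neg, inner_zero_right, AddChar.map_zero_eq_one,
      Circle.coe_one, inner_smul_right]
    set z : Circle := Real.fourierChar (inner ℝ ξ p) with hz
    have h2 : Real.fourierChar (2 * inner ℝ ξ p) = z * z := by
      rw [two_mul, AddChar.map_add_eq_mul]
    -- The symbol of the second difference is a perfect square, hence vanishes to second order in
    -- `p`.
    have hsq : ((z * z : Circle) : ℂ) - 2 * z + 1 = ((z : ℂ) - 1) ^ 2 := by push_cast; ring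
    have hz1 : ‖(z : ℂ) - 1‖ ≤ 2 * (Real.pi * (‖ξ‖ * ‖p‖)) :=
      (norm_fourierChar_inner_sub_one_le ξ p).trans_eq (by ring)
    have hz2 : ‖(z : ℂ) - 1‖ ≤ 2 := by
      refine (norm_sub_le _ _).trans ?_
      rw [Circle.norm_coe, norm_one]; norm_num
    -- Interpolation: for `y ≤ 1` use `|z - 1| ≤ 2y` and `y² ≤ y^b`; for `y ≥ 1` use `|z - 1| ≤ 2`
    -- and `y^b ≥ 1`.
    have hzb : ‖(z : ℂ) - 1‖ ^ 2 ≤ 4 * (Real.pi * (‖ξ‖ * ‖p‖)) ^ b := by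
      set y := Real.pi * (‖ξ‖ * ‖p‖) with hy
      have hy0 : 0 ≤ y := by positivity
      rcases le_total y 1 with h | h
      · calc ‖(z : ℂ) - 1‖ ^ 2 ≤ (2 * y) ^ 2 := by gcongr
          _ = 4 * y ^ (2 : ℝ) := by rw [Real.rpow_two]; ring
          _ ≤ 4 * y ^ b := by
            rcases eq_or_lt_of_le hy0 with h0 | h0
            · rw [← h0, Real.zero_rpow two_ne_zero]
              have := Real.rpow_nonneg le_rfl b
              linarith
            · gcongr 4 * ?_
              exact Real.rpow_le_rpow_of_exponent_ge h0 h hb2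
      · calc ‖(z : ℂ) - 1‖ ^ 2 ≤ 2 ^ 2 := by gcongr
          _ ≤ 4 * y ^ b := by
            have := Real.one_le_rpow h hb0
            linarith
    rw [h2, hsq, norm_pow]
    calc _ ≤ 4 * (Real.pi * (‖ξ‖ * ‖p‖)) ^ b * (C * weight N r ξ) := by
          gcongr
          exact hmr ξ
      _ = 4 * Real.pi ^ b * C * ‖p‖ ^ b * (‖ξ‖ ^ b * weight N r ξ) := by
          rw [Real.mul_rpow (by positivity) (by positivity),
            Real.mul_rpow (by positivity) (by positivity)]
          ring
      _ ≤ _ := by gcongr; exact norm_rpow_mul_weight_le hb0 r ξ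

/-- The symbol `(1 + |ξ|²)^(-s/2)`. -/
noncomputable def besselSymbol (N : ℕ) (s : ℝ) (ξ : Space N) : ℂ := (weight N s ξ : ℝ)

/-- The symbol `-4π²|ξ|² (1 + |ξ|²)^(-s/2)`. -/
noncomputable def laplacianSymbol (N : ℕ) (s : ℝ) (ξ : Space N) : ℂ :=
  ((-(2 * Real.pi) ^ 2 * (‖ξ‖ ^ 2 * weight N s ξ) : ℝ) : ℂ)

theorem continuous_besselSymbol (s : ℝ) : Continuous (besselSymbol N s) :=
  Complex.continuous_ofReal.comp (continuous_weight s)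

theorem continuous_laplacianSymbol (s : ℝ) : Continuous (laplacianSymbol N s) := by
  have := continuous_weight (N := N) s
  unfold laplacianSymbol
  fun_prop

theorem norm_besselSymbol_le (s : ℝ) (ξ : Space N) :
    ‖besselSymbol N s ξ‖ ≤ 1 * weight N s ξ := by
  rw [besselSymbol, Complex.norm_real, Real.norm_of_nonneg (weight_pos _ _).le, one_mul]

theorem norm_laplacianSymbol_le (s : ℝ) (ξ : Space N) :
    ‖laplacianSymbol N s ξ‖ ≤ (2 * Real.pi) ^ 2 * weight N (s - 2) ξ := by
  have hw := weight_pos s ξ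
  rw [laplacianSymbol, Complex.norm_real, norm_mul, norm_neg, Real.norm_of_nonneg (by positivity),
    Real.norm_of_nonneg (by positivity)]
  gcongr
  have := norm_rpow_mul_weight_le zero_le_two s ξ
  rwa [Real.rpow_two] at this

theorem hasTemperateGrowth_besselSymbol (s : ℝ) : (besselSymbol N s).HasTemperateGrowth := by
  unfold besselSymbol weight
  fun_prop

theorem hasTemperateGrowth_laplacianSymbol (s : ℝ) :
    (laplacianSymbol N s).HasTemperateGrowth := by
  unfold laplacianSymbol weight
  fun_prop

end

/-! ### Weak derivatives in time -/

section

/-- The primitive from `0` vanishes before the support of `ψ`, and also after it because the total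
integral is zero. -/
theorem exists_primitive_of_integral_eq_zero {T : ℝ} {ψ : ℝ → ℝ} (hψ : ContDiff ℝ ∞ ψ)
    (hc : HasCompactSupport ψ) (hsub : tsupport ψ ⊆ Set.Ioo 0 T) (h0 : ∫ t, ψ t = 0) :
    ∃ η : ℝ → ℝ, ContDiff ℝ ∞ η ∧ HasCompactSupport η ∧ tsupport η ⊆ Set.Ioo 0 T ∧
      deriv η = ψ := by
  rcases (tsupport ψ).eq_empty_or_nonempty with he | hne
  · have : ψ = 0 := by
      rwa [tsupport_eq_empty_iff] at he
    subst this
    exact ⟨0, contDiff_const, HasCompactSupport.zero, by simp, by simp⟩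
  obtain ⟨a, haK, ha⟩ := IsCompact.exists_isLeast (s := tsupport ψ) hc hne
  obtain ⟨b, hbK, hb⟩ := IsCompact.exists_isGreatest (s := tsupport ψ) hc hne
  have ha0 := hsub haK
  have hbT := hsub hbK
  have hzero : ∀ t, t ∉ Set.Icc a b → ψ t = 0 := fun t ht => by
    by_contra h
    have : t ∈ tsupport ψ := subset_tsupport _ h
    exact ht ⟨ha this, hb this⟩
  have hd : ∀ t, HasDerivAt (fun t => ∫ τ in (0 : ℝ)..t, ψ τ) (ψ t) t := fun t =>
    intervalIntegral.integral_hasDerivAt_right (hψ.continuous.intervalIntegrable _ _)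
      (hψ.continuous.stronglyMeasurableAtFilter _ _) hψ.continuous.continuousAt
  have hderiv : deriv (fun t => ∫ τ in (0 : ℝ)..t, ψ τ) = ψ := funext fun t => (hd t).deriv
  have hsupp : tsupport (fun t => ∫ τ in (0 : ℝ)..t, ψ τ) ⊆ Set.Icc a b := by
    refine closure_minimal (fun t ht => ?_) isClosed_Icc
    by_contra h
    apply ht
    rw [Set.mem_Icc, not_and_or, not_le, not_le] at h
    rcases h with h | h
    · have : ∫ τ in (0 : ℝ)..t, ψ τ = ∫ τ in (0 : ℝ)..t, (0 : ℝ) := by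
        refine intervalIntegral.integral_congr fun τ hτ => hzero τ fun hτ' => ?_
        have : τ ≤ max 0 t := hτ.2
        have := max_lt ha0.1 h
        linarith [hτ'.1]
      simpa using this
    · change ∫ τ in (0 : ℝ)..t, ψ τ = 0
      rw [← h0]
      refine intervalIntegral.integral_eq_integral_of_support_subset fun τ hτ => ?_
      have := subset_tsupport _ hτ
      have h1 := hb this
      have h2 := ha this
      exact ⟨by linarith [ha0.1], by linarith⟩
  refine ⟨_, ?_, ?_, hsupp.trans fun t ht => ⟨ha0.1.trans_le ht.1, ht.2.trans_lt hbT.2⟩, hderiv⟩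
  · rw [contDiff_infty_iff_deriv, hderiv]
    exact ⟨fun t => (hd t).differentiableAt, hψ⟩
  · exact isCompact_Icc.of_isClosed_subset (isClosed_tsupport _) hsupp

/-- The du Bois-Reymond lemma. -/
theorem exists_eq_const_of_integral_deriv_smul_eq_zero {T : ℝ} (hT : 0 < T) {c : ℝ → ℂ}
    (hc : Continuous c)
    (h : ∀ η : ℝ → ℝ, ContDiff ℝ ∞ η → HasCompactSupport η → tsupport η ⊆ Set.Ioo 0 T →
      ∫ t, deriv η t • c t = 0) :
    ∀ t ∈ Set.Icc 0 T, c t = c 0 := by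
  let f : ContDiffBump (T / 2) := ⟨T / 8, T / 4, by linarith, by linarith⟩
  set θ₀ := f.normed volume with hθ₀
  have hθ₀c : ContDiff ℝ ∞ θ₀ := f.contDiff_normed
  have hθ₀s : HasCompactSupport θ₀ := f.hasCompactSupport_normed
  have hθ₀t : tsupport θ₀ ⊆ Set.Ioo 0 T := by
    rw [f.tsupport_normed_eq, Real.closedBall_eq_Icc]
    intro t ht
    simp only [f] at ht
    exact ⟨by linarith [ht.1], by linarith [ht.2]⟩
  have hθ₀i : ∫ t, θ₀ t = 1 := f.integral_normed
  set K := ∫ t, θ₀ t • c t with hK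
  have hint : ∀ θ : ℝ → ℝ, Continuous θ → HasCompactSupport θ →
      Integrable fun t => θ t • c t := fun θ hθ hθs =>
    (hθ.smul hc).integrable_of_hasCompactSupport hθs.smul_right
  have key : ∀ᵐ t, t ∈ Set.Ioo 0 T → c t - K = 0 := by
    refine isOpen_Ioo.ae_eq_zero_of_integral_contDiff_smul_eq_zero
      ((hc.sub continuous_const).locallyIntegrable.locallyIntegrableOn _) fun θ hθ hθs hθt => ?_
    -- Subtracting a multiple of the normalised bump gives mean zero, so any test function becomes a
    -- derivative up to that multiple.
    obtain ⟨η, h1, h2, h3, h4⟩ := exists_primitive_of_integral_eq_zero (T := T)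
      (ψ := fun t => θ t - (∫ τ, θ τ) * θ₀ t) (hθ.sub (contDiff_const.mul hθ₀c))
      (hθs.sub hθ₀s.mul_left)
      ((tsupport_sub _ _).trans (Set.union_subset hθt
        ((tsupport_mul_subset_right).trans hθ₀t))) (by
        rw [integral_sub (hθ.continuous.integrable_of_hasCompactSupport hθs)
          ((hθ₀c.continuous.integrable_of_hasCompactSupport hθ₀s).const_mul _),
          integral_const_mul, hθ₀i]
        ring)
    have := h η h1 h2 h3
    rw [h4] at this
    simp_rw [sub_smul, mul_smul] at this
    have i1 : Integrable fun t => (∫ τ, θ τ) • θ₀ t • c t := 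
      Integrable.smul (∫ τ, θ τ) (hint _ hθ₀c.continuous hθ₀s)
    have i2 : Integrable fun t => θ t • K :=
      (hθ.continuous.integrable_of_hasCompactSupport hθs).smul_const K
    rw [integral_sub (hint _ hθ.continuous hθs) i1, integral_smul, ← hK, ← integral_smul_const,
      ← integral_sub (hint _ hθ.continuous hθs) i2] at this
    simpa only [smul_sub] using this
  have hIoo : Set.EqOn c (fun _ => K) (Set.Ioo 0 T) := by
    have : c =ᵐ[volume.restrict (Set.Ioo 0 T)] fun _ => K := by
      rw [EventuallyEq, ae_restrict_iff' measurableSet_Ioo]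
      filter_upwards [key] with t ht htT using sub_eq_zero.1 (ht htT)
    exact Measure.eqOn_open_of_ae_eq this isOpen_Ioo hc.continuousOn continuousOn_const
  have hIcc : Set.EqOn c (fun _ => K) (Set.Icc 0 T) := by
    rw [← closure_Ioo hT.ne]
    exact hIoo.closure hc continuous_const
  intro t ht
  rw [hIcc ht, hIcc ⟨le_rfl, hT.le⟩]

/-- A weak derivative on `(0,T)` of a continuous function, if continuous, is a derivative. -/
theorem sub_eq_integral_of_weak_deriv {T : ℝ} (hT : 0 < T) {a b : ℝ → ℂ} (ha : Continuous a)
    (hb : Continuous b)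
    (h : ∀ η : ℝ → ℝ, ContDiff ℝ ∞ η → HasCompactSupport η → tsupport η ⊆ Set.Ioo 0 T →
      ∫ t in (0 : ℝ)..T, -(deriv η t • a t) = ∫ t in (0 : ℝ)..T, η t • b t) :
    ∀ t ∈ Set.Icc 0 T, a t - a 0 = ∫ τ in (0 : ℝ)..t, b τ := by
  have hB : ∀ t, HasDerivAt (fun t => ∫ τ in (0 : ℝ)..t, b τ) (b t) t := fun t =>
    intervalIntegral.integral_hasDerivAt_right (hb.intervalIntegrable _ _)
      (hb.stronglyMeasurableAtFilter _ _) hb.continuousAt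
  have hBc : Continuous fun t => ∫ τ in (0 : ℝ)..t, b τ :=
    continuous_iff_continuousAt.2 fun t => (hB t).continuousAt
  -- After subtraction of the primitive of `b`, integration by parts shows that the weak derivative
  -- is zero.
  have := exists_eq_const_of_integral_deriv_smul_eq_zero hT
    (c := fun t => a t - ∫ τ in (0 : ℝ)..t, b τ) (ha.sub hBc) fun η h1 h2 h3 => ?_
  · intro t ht
    have := this t ht
    simp only [intervalIntegral.integral_same, sub_zero] at this
    rw [← this]; ring
  · have hη : Continuous (deriv η) := h1.continuous_deriv (by simp)
    have e1 : ∫ t, deriv η t • (a t - ∫ τ in (0 : ℝ)..t, b τ) =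
        ∫ t in (0 : ℝ)..T, deriv η t • (a t - ∫ τ in (0 : ℝ)..t, b τ) := by
      symm
      refine intervalIntegral.integral_eq_integral_of_support_subset fun t ht => ?_
      have : t ∈ tsupport η := by
        refine support_deriv_subset fun h0 => ht ?_
        simp [h0]
      exact Set.Ioo_subset_Ioc_self (h3 this)
    have e2 : ∫ t in (0 : ℝ)..T, deriv η t • (∫ τ in (0 : ℝ)..t, b τ) =
        - ∫ t in (0 : ℝ)..T, η t • b t := by
      have hη0 : η 0 = 0 := image_eq_zero_of_notMem_tsupport fun h => lt_irrefl _ (h3 h).1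
      have hηT : η T = 0 := image_eq_zero_of_notMem_tsupport fun h => lt_irrefl _ (h3 h).2
      have := intervalIntegral.integral_smul_deriv_eq_deriv_smul (a := 0) (b := T)
        (u := η) (u' := deriv η) (v := fun t => ∫ τ in (0 : ℝ)..t, b τ) (v' := b)
        (fun t _ => (h1.differentiable (by simp) t).hasDerivAt) (fun t _ => hB t)
        (hη.intervalIntegrable _ _) (hb.intervalIntegrable _ _)
      rw [this, hη0, hηT]
      simp
    rw [e1]
    simp_rw [smul_sub]
    have i1 : IntervalIntegrable (fun t => deriv η t • a t) volume 0 T :=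
      (hη.smul ha).intervalIntegrable _ _
    have i2 : IntervalIntegrable (fun t => deriv η t • ∫ τ in (0 : ℝ)..t, b τ) volume 0 T :=
      (hη.smul hBc).intervalIntegrable _ _
    rw [intervalIntegral.integral_sub i1 i2, e2, ← h η h1 h2 h3, intervalIntegral.integral_neg]
    ring

end

/-! ### The nonlinearity and the right-hand side of the equation -/

section

variable {N : ℕ} {s : ℝ}

/-- The nonlinearity `λ |z|^α z`. -/
noncomputable def nonlin (α : ℝ) (lam z : ℂ) : ℂ := lam * ((‖z‖ ^ α : ℝ) : ℂ) * z

theorem nonlin_neg (α : ℝ) (lam z : ℂ) : nonlin α lam (-z) = -nonlin α lam z := by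
  simp [nonlin]

theorem nonlin_zero (α : ℝ) (lam : ℂ) : nonlin α lam 0 = 0 := by simp [nonlin]

theorem continuous_nonlin {α : ℝ} (hα : 0 < α) (lam : ℂ) : Continuous (nonlin α lam) := by
  have : Continuous fun z : ℂ => ‖z‖ ^ α := continuous_norm.rpow_const fun _ => Or.inr hα.le
  unfold nonlin
  fun_prop

/-- After cancellation this is `x/y ≤ (x/y)^α`, true because `x/y ≤ 1` and `α < 1`. -/
theorem rpow_sub_rpow_mul_le {α x y : ℝ} (hα0 : 0 < α) (hα1 : α < 1) (hx : 0 ≤ x) (hxy : x ≤ y) :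
    (y ^ α - x ^ α) * y ≤ y ^ α * (y - x) := by
  rcases hx.eq_or_lt with rfl | hx0
  · simp [Real.zero_rpow hα0.ne']
  have hy : 0 < y := hx0.trans_le hxy
  have h : x / y ≤ (x / y) ^ α := by
    have := Real.rpow_le_rpow_of_exponent_ge (div_pos hx0 hy) (div_le_one_of_le₀ hxy hy.le) hα1.le
    rwa [Real.rpow_one] at this
  rw [Real.div_rpow hx hy.le, div_le_div_iff₀ hy (by positivity)] at h
  linarith

/-- With `|a| ≤ |b|`, the difference splits as `|a|^α(a - b) - (|b|^α - |a|^α)b`; the second term is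
no worse than the first by `rpow_sub_rpow_mul_le`. The factor `M^α` matters later, when `M` is of
size `h`. -/
theorem norm_nonlin_sub_le {α : ℝ} (hα0 : 0 < α) (hα1 : α < 1) (lam : ℂ) {M : ℝ} {a b : ℂ}
    (ha : ‖a‖ ≤ M) (hb : ‖b‖ ≤ M) :
    ‖nonlin α lam a - nonlin α lam b‖ ≤ 2 * ‖lam‖ * M ^ α * ‖a - b‖ := by
  wlog hab : ‖a‖ ≤ ‖b‖ generalizing a b
  · rw [norm_sub_rev, norm_sub_rev a]
    exact this hb ha (le_of_not_ge hab)
  have e : nonlin α lam a - nonlin α lam b =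
      lam * (((‖a‖ ^ α : ℝ) : ℂ) * (a - b) - ((‖b‖ ^ α - ‖a‖ ^ α : ℝ) : ℂ) * b) := by
    simp only [nonlin]; push_cast; ring
  have hpow : ‖a‖ ^ α ≤ ‖b‖ ^ α := by gcongr
  have hbM : ‖b‖ ^ α ≤ M ^ α := by gcongr
  have h1 : (‖b‖ ^ α - ‖a‖ ^ α) * ‖b‖ ≤ ‖b‖ ^ α * ‖a - b‖ :=
    (rpow_sub_rpow_mul_le hα0 hα1 (norm_nonneg _) hab).trans (by
      gcongr
      rw [norm_sub_rev]
      exact norm_sub_norm_le _ _)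
  rw [e, norm_mul]
  have h2 : ‖((‖a‖ ^ α : ℝ) : ℂ) * (a - b) - ((‖b‖ ^ α - ‖a‖ ^ α : ℝ) : ℂ) * b‖ ≤
      ‖a‖ ^ α * ‖a - b‖ + (‖b‖ ^ α - ‖a‖ ^ α) * ‖b‖ := by
    refine (norm_sub_le _ _).trans (le_of_eq ?_)
    rw [norm_mul, norm_mul, Complex.norm_real, Complex.norm_real,
      Real.norm_of_nonneg (by positivity), Real.norm_of_nonneg (by linarith)]
  calc _ ≤ ‖lam‖ * (M ^ α * ‖a - b‖ + M ^ α * ‖a - b‖) := by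
        gcongr
        refine h2.trans (add_le_add ?_ (h1.trans ?_)) <;> gcongr
    _ = _ := by ring

section Operators

theorem memLp_top_besselSymbol (hs : (N : ℝ) / 2 + 3 < s) : MemLp (besselSymbol N s) ⊤ volume :=
  memLp_top_of_norm_le_weight (continuous_besselSymbol s)
    (by have : (0 : ℝ) ≤ N := N.cast_nonneg
        linarith) (norm_besselSymbol_le s)

theorem memLp_two_besselSymbol (hs : (N : ℝ) / 2 + 3 < s) : MemLp (besselSymbol N s) 2 volume :=
  memLp_two_of_norm_le_weight (continuous_besselSymbol s) (by linarith) (norm_besselSymbol_le s)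

theorem memLp_top_laplacianSymbol (hs : (N : ℝ) / 2 + 3 < s) :
    MemLp (laplacianSymbol N s) ⊤ volume :=
  memLp_top_of_norm_le_weight (continuous_laplacianSymbol s)
    (by have : (0 : ℝ) ≤ N := N.cast_nonneg
        linarith) (norm_laplacianSymbol_le s)

theorem memLp_two_laplacianSymbol (hs : (N : ℝ) / 2 + 3 < s) :
    MemLp (laplacianSymbol N s) 2 volume :=
  memLp_two_of_norm_le_weight (continuous_laplacianSymbol s) (by linarith)
    (norm_laplacianSymbol_le s)

/-- `J_{-s}` on `L²`. -/
noncomputable def solMul (hs : (N : ℝ) / 2 + 3 < s) : L2 N →L[ℂ] L2 N :=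
  fourierMul _ (memLp_top_besselSymbol hs)

/-- `J_{-s}` from `L²` to bounded continuous functions. -/
noncomputable def solEval (hs : (N : ℝ) / 2 + 3 < s) : L2 N →L[ℂ] (Space N →ᵇ ℂ) :=
  fourierEval _ (memLp_two_besselSymbol hs)

/-- `Δ J_{-s}` on `L²`. -/
noncomputable def lapMul (hs : (N : ℝ) / 2 + 3 < s) : L2 N →L[ℂ] L2 N :=
  fourierMul _ (memLp_top_laplacianSymbol hs)

/-- `Δ J_{-s}` from `L²` to bounded continuous functions. -/
noncomputable def lapEval (hs : (N : ℝ) / 2 + 3 < s) : L2 N →L[ℂ] (Space N →ᵇ ℂ) :=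
  fourierEval _ (memLp_two_laplacianSymbol hs)

theorem solMul_ae_eq (hs : (N : ℝ) / 2 + 3 < s) (f : L2 N) : solMul hs f =ᵐ[volume] solEval hs f :=
  fourierMul_ae_eq_fourierEval _ _ _ f

theorem lapMul_ae_eq (hs : (N : ℝ) / 2 + 3 < s) (f : L2 N) : lapMul hs f =ᵐ[volume] lapEval hs f :=
  fourierMul_ae_eq_fourierEval _ _ _ f

/-- `J_{-s}` inverts `J_s` on tempered distributions, and `L²` embeds injectively there. -/
theorem eq_solMul_of_besselPotential_eq (hs : (N : ℝ) / 2 + 3 < s) {u v : L2 N}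
    (h : besselPotential (Space N) ℂ s (u : 𝓢'(Space N, ℂ)) = (v : 𝓢'(Space N, ℂ))) :
    u = solMul hs v := by
  apply toTemperedDistribution_injective
  rw [solMul, fourierMul_toTemperedDistribution _ _ (hasTemperateGrowth_besselSymbol s)]
  have : besselPotential (Space N) ℂ (-s) (v : 𝓢'(Space N, ℂ)) = (u : 𝓢'(Space N, ℂ)) := by
    rw [← h, besselPotential_besselPotential_apply]
    simp
  rw [← this]
  rfl

/-- Composition of multipliers multiplies symbols; the factor `-(2π)²` is the Laplacian's symbol in
this normalisation of the Fourier transform. -/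
theorem laplacian_solMul (hs : (N : ℝ) / 2 + 3 < s) (v : L2 N) :
    Laplacian.laplacian (solMul hs v : 𝓢'(Space N, ℂ)) = (lapMul hs v : 𝓢'(Space N, ℂ)) := by
  rw [laplacian_eq_fourierMultiplierCLM, solMul, lapMul,
    fourierMul_toTemperedDistribution _ _ (hasTemperateGrowth_besselSymbol s),
    fourierMul_toTemperedDistribution _ _ (hasTemperateGrowth_laplacianSymbol s),
    fourierMultiplierCLM_fourierMultiplierCLM_apply (hasTemperateGrowth_besselSymbol s)
      (by fun_prop)]
  have : laplacianSymbol N s = ((-(2 * Real.pi) ^ 2 : ℝ) : ℂ) •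
      (besselSymbol N s * fun x : Space N => Complex.ofReal (‖x‖ ^ 2)) := by
    ext ξ
    simp only [laplacianSymbol, besselSymbol, Pi.smul_apply, Pi.mul_apply, smul_eq_mul]
    push_cast; ring
  rw [this, fourierMultiplierCLM_smul ((hasTemperateGrowth_besselSymbol s).mul (by fun_prop))]
  rw [_root_.smul_apply, Complex.coe_smul]

theorem integral_laplacian_mul_solMul (hs : (N : ℝ) / 2 + 3 < s) (v : L2 N) (Z : 𝓢(Space N, ℂ)) :
    ∫ x, Laplacian.laplacian (Z : Space N → ℂ) x * solMul hs v x = ∫ x, Z x * lapMul hs v x := by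
  have h := congrArg (fun F : 𝓢'(Space N, ℂ) => F Z) (laplacian_solMul hs v)
  simp only [laplacian_apply_apply, Lp.toTemperedDistribution_apply, smul_eq_mul,
    SchwartzMap.laplacian_apply] at h
  exact h

end Operators

section Nonlinear

variable {α : ℝ} {lam : ℂ}

theorem norm_nonlin (α : ℝ) (lam z : ℂ) : ‖nonlin α lam z‖ = ‖lam‖ * ‖z‖ ^ α * ‖z‖ := by
  rw [nonlin, norm_mul, norm_mul, Complex.norm_real, Real.norm_of_nonneg (by positivity)]

/-- `J_{-s} v` is bounded and in `L²`, so `|u|^α` is a bounded factor. -/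
theorem memLp_nonlin (hα : 0 < α) (lam : ℂ) (hs : (N : ℝ) / 2 + 3 < s) (v : L2 N) :
    MemLp (fun x => nonlin α lam (solEval hs v x)) 2 volume := by
  have h : MemLp (fun x => solEval hs v x) 2 volume :=
    (Lp.memLp (solMul hs v)).ae_eq (solMul_ae_eq hs v)
  refine (h.norm.const_mul (‖lam‖ * ‖solEval hs v‖ ^ α)).mono'
    ((continuous_nonlin hα lam).comp (solEval hs v).continuous).aestronglyMeasurable
    (Eventually.of_forall fun x => ?_)
  rw [norm_nonlin]
  gcongr
  exact (solEval hs v).norm_coe_le_norm x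

/-- The right-hand side `Δu + λ|u|^α u` of the equation at `u = J_{-s} v`, in `L²`. -/
noncomputable def rhs (hα : 0 < α) (lam : ℂ) (hs : (N : ℝ) / 2 + 3 < s) (v : L2 N) : L2 N :=
  lapMul hs v + (memLp_nonlin hα lam hs v).toLp _

/-- The right-hand side `Δu + λ|u|^α u` of the equation at `u = J_{-s} v`, pointwise. -/
noncomputable def rhsEval (α : ℝ) (lam : ℂ) (hs : (N : ℝ) / 2 + 3 < s) (v : L2 N) (x : Space N) :
    ℂ :=
  lapEval hs v x + nonlin α lam (solEval hs v x)

theorem rhs_ae_eq (hα : 0 < α) (lam : ℂ) (hs : (N : ℝ) / 2 + 3 < s) (v : L2 N) :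
    rhs hα lam hs v =ᵐ[volume] rhsEval α lam hs v := by
  filter_upwards [Lp.coeFn_add (lapMul hs v) ((memLp_nonlin hα lam hs v).toLp _),
    lapMul_ae_eq hs v, (memLp_nonlin hα lam hs v).coeFn_toLp] with x h1 h2 h3
  rw [rhs, h1, Pi.add_apply, h2, h3, rhsEval]

theorem norm_toLp_nonlin_sub_le (hα0 : 0 < α) (hα1 : α < 1) (lam : ℂ) (hs : (N : ℝ) / 2 + 3 < s)
    {M : ℝ} {v w : L2 N} (hv : ‖solEval hs v‖ ≤ M) (hw : ‖solEval hs w‖ ≤ M) :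
    ‖(memLp_nonlin hα0 lam hs v).toLp _ - (memLp_nonlin hα0 lam hs w).toLp _‖ ≤
      2 * ‖lam‖ * M ^ α * ‖solMul hs v - solMul hs w‖ := by
  apply Lp.norm_le_mul_norm_of_ae_le_mul
  filter_upwards [Lp.coeFn_sub ((memLp_nonlin hα0 lam hs v).toLp _)
    ((memLp_nonlin hα0 lam hs w).toLp _), (memLp_nonlin hα0 lam hs v).coeFn_toLp,
    (memLp_nonlin hα0 lam hs w).coeFn_toLp, Lp.coeFn_sub (solMul hs v) (solMul hs w),
    solMul_ae_eq hs v, solMul_ae_eq hs w] with x h1 h2 h3 h4 h5 h6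
  rw [h1, h4, Pi.sub_apply, Pi.sub_apply, h2, h3, h5, h6]
  exact norm_nonlin_sub_le hα0 hα1 lam (((solEval hs v).norm_coe_le_norm x).trans hv)
    (((solEval hs w).norm_coe_le_norm x).trans hw)

theorem continuous_rhs (hα0 : 0 < α) (hα1 : α < 1) (lam : ℂ) (hs : (N : ℝ) / 2 + 3 < s) :
    Continuous (rhs (N := N) hα0 lam hs) := by
  refine (lapMul hs).continuous.add (continuous_iff_continuousAt.2 fun v => ?_)
  rw [ContinuousAt, tendsto_iff_norm_sub_tendsto_zero]
  refine squeeze_zero (fun _ => norm_nonneg _) (fun w => norm_toLp_nonlin_sub_le hα0 hα1 lam hs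
    (M := ‖solEval hs w‖ + ‖solEval hs v‖) (by simp) (by simp)) ?_
  have : Continuous fun w => 2 * ‖lam‖ * (‖solEval hs w‖ + ‖solEval hs v‖) ^ α *
      ‖solMul hs w - solMul hs v‖ := by
    have h1 : Continuous fun w => (‖solEval hs w‖ + ‖solEval hs v‖) ^ α :=
      Continuous.rpow_const (by fun_prop) fun _ => Or.inr hα0.le
    fun_prop
  simpa using this.tendsto v

end Nonlinear

end

/-! ### From the distributional equation to integrated equations -/

section

variable {N : ℕ} {s α T : ℝ} {lam : ℂ}

/-- Integration against a Schwartz function. -/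
noncomputable def pairing (Z : 𝓢(Space N, ℂ)) : L2 N →L[ℂ] ℂ :=
  (ContinuousLinearMap.mul ℂ ℂ).lpPairing volume 2 2 (Z.toLp 2)

theorem pairing_apply (Z : 𝓢(Space N, ℂ)) (f : L2 N) : pairing Z f = ∫ x, Z x * f x := by
  rw [pairing, ContinuousLinearMap.lpPairing_eq_integral]
  apply integral_congr_ae
  filter_upwards [Z.coeFn_toLp 2 volume] with x hx
  simp [hx]

theorem integrable_schwartz_mul (Z : 𝓢(Space N, ℂ)) (f : L2 N) : Integrable fun x => Z x * f x :=
  MemLp.integrable_mul (Z.memLp 2 volume) (Lp.memLp f)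

theorem ContinuousInSobolev.exists_profile (hs : (N : ℝ) / 2 + 3 < s) (hT : 0 < T) {u : ℝ → L2 N}
    (hu : ContinuousInSobolev N s T u) :
    ∃ v : ℝ → L2 N, Continuous v ∧ ∀ t ∈ Set.Icc 0 T, u t = solMul hs (v t) := by
  obtain ⟨v, hv, h⟩ := hu
  -- Constant extension beyond `[0,T]` makes the profile continuous on all of `ℝ`, so no one-sided
  -- limits are needed later.
  refine ⟨Set.IccExtend hT.le ((Set.Icc 0 T).domRestrict v), hv.domRestrict.Icc_extend', fun t ht => ?_⟩
  rw [Set.IccExtend_of_mem _ _ ht]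
  exact eq_solMul_of_besselPotential_eq hs (h t ht)

theorem integral_laplacian_add_nonlin (hα : 0 < α) (hs : (N : ℝ) / 2 + 3 < s) (v : L2 N)
    (Z : 𝓢(Space N, ℂ)) (r : ℝ) :
    ∫ x, (solMul hs v x * Laplacian.laplacian (fun z : Space N => r • Z z) x +
      lam * ((‖solMul hs v x‖ ^ α : ℝ) : ℂ) * solMul hs v x * (r • Z x)) =
      r • pairing Z (rhs hα lam hs v) := by
  have hlap : ∀ x, Laplacian.laplacian (fun z : Space N => r • Z z) x =
      r • Laplacian.laplacian (Z : Space N → ℂ) x := fun x =>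
    InnerProductSpace.laplacian_smul r ((Z.smooth 2).contDiffAt)
  set G : L2 N := (memLp_nonlin hα lam hs v).toLp _ with hG
  have i1 : Integrable fun x => Laplacian.laplacian (Z : Space N → ℂ) x * solMul hs v x := by
    simpa only [SchwartzMap.laplacian_apply] using
      integrable_schwartz_mul (Laplacian.laplacian Z) (solMul hs v)
  have i2 := integrable_schwartz_mul Z G
  calc _ = ∫ x, r • (Laplacian.laplacian (Z : Space N → ℂ) x * solMul hs v x + Z x * G x) := by
        apply integral_congr_ae
        filter_upwards [(memLp_nonlin hα lam hs v).coeFn_toLp, solMul_ae_eq hs v] with x h1 h2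
        rw [hlap, hG, h1, h2]
        simp only [nonlin, Complex.real_smul]
        ring
    _ = r • (pairing Z (lapMul hs v) + pairing Z G) := by
        rw [integral_smul, integral_add i1 i2, integral_laplacian_mul_solMul, pairing_apply,
          pairing_apply]
    _ = _ := by rw [← map_add]; rfl

/-- The equation tested against a function of `x` and integrated in time. -/
theorem SolvesEquation.pairing_sub_eq (hα0 : 0 < α) (hα1 : α < 1) (hs : (N : ℝ) / 2 + 3 < s)
    (hT : 0 < T) {u : ℝ → L2 N} (hu : SolvesEquation N α lam T u) {v : ℝ → L2 N}
    (hv : Continuous v) (huv : ∀ t ∈ Set.Icc 0 T, u t = solMul hs (v t)) (Z : 𝓢(Space N, ℂ))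
    (hZ : HasCompactSupport Z) {t : ℝ} (ht : t ∈ Set.Icc 0 T) :
    Complex.I * pairing Z (solMul hs (v t)) - Complex.I * pairing Z (solMul hs (v 0)) =
      ∫ τ in (0 : ℝ)..t, pairing Z (rhs hα0 lam hs (v τ)) := by
  refine sub_eq_integral_of_weak_deriv hT (a := fun t => Complex.I * pairing Z (solMul hs (v t)))
    (b := fun t => pairing Z (rhs hα0 lam hs (v t))) (by fun_prop)
    ((pairing Z).continuous.comp ((continuous_rhs hα0 hα1 lam hs).comp hv)) (fun η h1 h2 h3 => ?_)
    t ht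
  have hsub : tsupport (fun p : ℝ × Space N => η p.1 • Z p.2) ⊆ tsupport η ×ˢ tsupport Z := by
    refine closure_minimal (fun p hp => ?_) ((isClosed_tsupport _).prod (isClosed_tsupport _))
    have hp' : η p.1 • Z p.2 ≠ 0 := hp
    exact ⟨subset_tsupport _ (left_ne_zero_of_smul hp'),
      subset_tsupport _ (right_ne_zero_of_smul hp')⟩
  -- Separated test functions suffice: they turn the equation into a scalar weak derivative in `t`.
  have key := hu (fun p => η p.1 • Z p.2)
    ((h1.comp contDiff_fst).smul ((Z.smooth ⊤).comp contDiff_snd))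
    ((h2.prod hZ).of_isClosed_subset (isClosed_tsupport _) hsub)
    (hsub.trans (Set.prod_mono h3 (Set.subset_univ _)))
  calc _ = ∫ t in (0 : ℝ)..T, ∫ x : Space N,
        -Complex.I * u t x * deriv (fun τ => η τ • Z x) t := by
        refine intervalIntegral.integral_congr fun t ht => ?_
        rw [Set.uIcc_of_le hT.le] at ht
        rw [pairing_apply, ← integral_const_mul, ← integral_smul, ← integral_neg, huv t ht]
        congr with x
        have : deriv (fun τ => η τ • Z x) t = deriv η t • Z x :=
          (((h1.differentiable (by simp) t).hasDerivAt).smul_const (Z x)).deriv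
        rw [this]
        simp only [Complex.real_smul]
        ring
    _ = _ := key
    _ = _ := by
        refine intervalIntegral.integral_congr fun t ht => ?_
        rw [Set.uIcc_of_le hT.le] at ht
        simp only
        rw [huv t ht]
        exact integral_laplacian_add_nonlin hα0 hs (v t) Z (η t)

theorem eq_zero_of_pairing_eq_zero (f : L2 N)
    (h : ∀ Z : 𝓢(Space N, ℂ), HasCompactSupport Z → pairing Z f = 0) : f = 0 := by
  rw [Lp.eq_zero_iff_ae_eq_zero]
  refine ae_eq_zero_of_integral_contDiff_smul_eq_zero
    ((Lp.memLp f).locallyIntegrable (by norm_num)) fun g hg hgs => ?_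
  have hg₁ : HasCompactSupport (Complex.ofRealCLM ∘ g) := hgs.comp_left rfl
  have hg₂ : ContDiff ℝ ∞ (Complex.ofRealCLM ∘ g) := by fun_prop
  have := h (hg₁.toSchwartzMap hg₂) hg₁
  rw [pairing_apply] at this
  simpa using this

/-- The integrated equation in `L²`. -/
theorem SolvesEquation.solMul_sub_eq (hα0 : 0 < α) (hα1 : α < 1) (hs : (N : ℝ) / 2 + 3 < s)
    (hT : 0 < T) {u : ℝ → L2 N} (hu : SolvesEquation N α lam T u) {v : ℝ → L2 N}
    (hv : Continuous v) (huv : ∀ t ∈ Set.Icc 0 T, u t = solMul hs (v t))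
    {t : ℝ} (ht : t ∈ Set.Icc 0 T) :
    Complex.I • (solMul hs (v t) - solMul hs (v 0)) =
      ∫ τ in (0 : ℝ)..t, rhs hα0 lam hs (v τ) := by
  rw [← sub_eq_zero]
  refine eq_zero_of_pairing_eq_zero _ fun Z hZ => ?_
  have hc : Continuous fun τ => rhs hα0 lam hs (v τ) := (continuous_rhs hα0 hα1 lam hs).comp hv
  rw [map_sub, ← ContinuousLinearMap.intervalIntegral_comp_comm _ (hc.intervalIntegrable _ _),
    ← hu.pairing_sub_eq hα0 hα1 hs hT hv huv Z hZ ht, map_smul, map_sub, smul_eq_mul]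
  ring

/-- The integrated equation, pointwise. -/
theorem SolvesEquation.solEval_sub_eq (hα0 : 0 < α) (hα1 : α < 1) (hs : (N : ℝ) / 2 + 3 < s)
    (hT : 0 < T) {u : ℝ → L2 N} (hu : SolvesEquation N α lam T u) {v : ℝ → L2 N}
    (hv : Continuous v) (huv : ∀ t ∈ Set.Icc 0 T, u t = solMul hs (v t))
    {t : ℝ} (ht : t ∈ Set.Icc 0 T) (x : Space N) :
    Complex.I * (solEval hs (v t) x - solEval hs (v 0) x) =
      ∫ τ in (0 : ℝ)..t, rhsEval α lam hs (v τ) x := by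
  have hc : Continuous fun p : Space N × ℝ => rhsEval α lam hs (v p.2) p.1 := by
    have := continuous_nonlin hα0 lam
    unfold rhsEval
    fun_prop
  have hcF : Continuous fun x => ∫ τ in (0 : ℝ)..t, rhsEval α lam hs (v τ) x :=
    intervalIntegral.continuous_parametric_intervalIntegral_of_continuous' hc 0 t
  have hcD : Continuous fun x => Complex.I * (solEval hs (v t) x - solEval hs (v 0) x) := by
    fun_prop
  -- Both sides are continuous in `x`, so equality almost everywhere, checked against test
  -- functions, is equality everywhere.
  revert x
  rw [← funext_iff, ← hcD.ae_eq_iff_eq volume hcF]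
  refine ae_eq_of_integral_contDiff_smul_eq hcD.locallyIntegrable hcF.locallyIntegrable
    fun g hg hgs => ?_
  have hg₁ : HasCompactSupport (Complex.ofRealCLM ∘ g) := hgs.comp_left rfl
  have hg₂ : ContDiff ℝ ∞ (Complex.ofRealCLM ∘ g) := by fun_prop
  have key := hu.pairing_sub_eq hα0 hα1 hs hT hv huv (hg₁.toSchwartzMap hg₂) hg₁ ht
  set Z := hg₁.toSchwartzMap hg₂
  have hZ : ∀ x, Z x = g x := fun x => rfl
  have hsol : ∀ w : L2 N, pairing Z (solMul hs w) = ∫ x, g x • solEval hs w x := fun w => by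
    rw [pairing_apply]
    apply integral_congr_ae
    filter_upwards [solMul_ae_eq hs w] with x hx
    rw [hx, hZ, Complex.real_smul]
  have hrhs : ∀ w : L2 N, pairing Z (rhs hα0 lam hs w) = ∫ x, g x • rhsEval α lam hs w x :=
    fun w => by
      rw [pairing_apply]
      apply integral_congr_ae
      filter_upwards [rhs_ae_eq hα0 lam hs w] with x hx
      rw [hx, hZ, Complex.real_smul]
  have hint : ∀ w : L2 N, Integrable fun x => g x • solEval hs w x := fun w =>
    (hg.continuous.smul (solEval hs w).continuous).integrable_of_hasCompactSupport hgs.smul_right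
  calc _ = Complex.I * (∫ x, g x • solEval hs (v t) x) -
        Complex.I * ∫ x, g x • solEval hs (v 0) x := by
        rw [← mul_sub, ← integral_sub (hint _) (hint _), ← integral_const_mul]
        congr with x
        simp only [Complex.real_smul]
        ring
    _ = ∫ τ in (0 : ℝ)..t, ∫ x, g x • rhsEval α lam hs (v τ) x := by
        rw [← hsol, ← hsol, key]
        simp_rw [hrhs]
    _ = _ := by
        rw [intervalIntegral_integral_swap]
        · simp_rw [intervalIntegral.integral_smul]
        · have hcont : Continuous (Function.uncurry fun (τ : ℝ) (x : Space N) =>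
              g x • rhsEval α lam hs (v τ) x) :=
            Continuous.smul (f := fun p : ℝ × Space N => g p.2)
              (g := fun p : ℝ × Space N => rhsEval α lam hs (v p.1) p.2)
              (hg.continuous.comp continuous_snd)
              (Continuous.comp (g := fun p : Space N × ℝ => rhsEval α lam hs (v p.2) p.1)
                (f := fun p : ℝ × Space N => (p.2, p.1)) hc (by fun_prop))
          have : IntegrableOn (Function.uncurry fun (τ : ℝ) (x : Space N) =>
              g x • rhsEval α lam hs (v τ) x) (Set.uIcc 0 t ×ˢ Set.univ)
              ((volume : Measure ℝ).prod volume) := by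
            have h1 := (hcont.continuousOn (s := Set.uIcc 0 t ×ˢ tsupport g)).integrableOn_compact
              (μ := (volume : Measure ℝ).prod volume) (isCompact_uIcc.prod hgs)
            refine h1.of_forall_sdiff_eq_zero (measurableSet_uIcc.prod MeasurableSet.univ) ?_
            rintro ⟨τ, x⟩ ⟨⟨hτ, -⟩, hx⟩
            have : x ∉ tsupport g := fun h => hx ⟨hτ, h⟩
            simp [image_eq_zero_of_notMem_tsupport this]
          rw [IntegrableOn, ← Measure.prod_restrict, Measure.restrict_univ] at this
          exact this.mono_measure (Measure.prod_mono
            (Measure.restrict_mono Set.uIoc_subset_uIcc le_rfl) le_rfl)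

end

/-! ### Reflection symmetry and preservation of oddness -/

section

variable {N : ℕ} {s α T : ℝ} {lam : ℂ}

/-- The reflection `f ↦ f(-·)` on `L²`. -/
noncomputable def reflect (N : ℕ) : L2 N →ₗᵢ[ℂ] L2 N :=
  Lp.compMeasurePreservingₗᵢ ℂ (fun x : Space N => -x) (Measure.measurePreserving_neg volume)

theorem reflect_ae_eq {f : L2 N} {F : Space N → ℂ} (h : f =ᵐ[volume] F) :
    reflect N f =ᵐ[volume] fun x => F (-x) :=
  (Lp.coeFn_compMeasurePreserving f (Measure.measurePreserving_neg volume)).trans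
    ((Measure.measurePreserving_neg volume).quasiMeasurePreserving.ae_eq_comp h)

theorem integral_mul_reflect (g : Space N → ℂ) (f : L2 N) :
    ∫ x, g x * reflect N f x = ∫ x, g (-x) * f x := by
  rw [← integral_neg_eq_self (fun x => g (-x) * f x)]
  apply integral_congr_ae
  filter_upwards [reflect_ae_eq (f := f) (ae_eq_refl _)] with x hx
  rw [hx, neg_neg]

/-- By duality from Schwartz functions: reflection is its own transpose and commutes with the
Fourier transform there. -/
theorem fourier_reflect (f : L2 N) : (𝓕 (reflect N f) : L2 N) = reflect N (𝓕 f) := by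
  apply toTemperedDistribution_injective
  ext g
  let g' : 𝓢(Space N, ℂ) := SchwartzMap.compCLMOfContinuousLinearEquiv ℂ
    (ContinuousLinearEquiv.neg ℝ : Space N ≃L[ℝ] Space N) g
  have hg' : ∀ x, g' x = g (-x) := fun x => rfl
  have hF : ∀ x, (𝓕 g' : 𝓢(Space N, ℂ)) x = (𝓕 g : 𝓢(Space N, ℂ)) (-x) := fun x => by
    rw [SchwartzMap.fourier_coe, SchwartzMap.fourier_coe]
    exact Real.fourier_comp_linearIsometry (LinearIsometryEquiv.neg ℝ) g x
  rw [← Lp.fourier_toTemperedDistribution_eq, TemperedDistribution.fourier_apply,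
    Lp.toTemperedDistribution_apply, Lp.toTemperedDistribution_apply]
  simp only [smul_eq_mul]
  rw [integral_mul_reflect, integral_mul_reflect]
  have h := congrArg (fun F : 𝓢'(Space N, ℂ) => F g') (Lp.fourier_toTemperedDistribution_eq f)
  simp only [TemperedDistribution.fourier_apply, Lp.toTemperedDistribution_apply, smul_eq_mul,
    hF, hg'] at h
  exact h

theorem reflect_fourierMul {m : Space N → ℂ} (hm : MemLp m ⊤ volume) (heven : ∀ ξ, m (-ξ) = m ξ)
    (f : L2 N) : reflect N (fourierMul m hm f) = fourierMul m hm (reflect N f) := by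
  apply (Lp.fourierTransformₗᵢ (Space N) ℂ).injective
  change (𝓕 (reflect N (fourierMul m hm f)) : L2 N) = 𝓕 (fourierMul m hm (reflect N f))
  rw [fourier_reflect]
  refine Lp.ext ?_
  filter_upwards [reflect_ae_eq (fourier_fourierMul_ae_eq m hm f),
    fourier_fourierMul_ae_eq m hm (reflect N f), reflect_ae_eq (f := (𝓕 f : L2 N)) (ae_eq_refl _)]
    with ξ h1 h2 h3
  rw [h1, h2, fourier_reflect, h3, heven]

theorem weight_neg (r : ℝ) (ξ : Space N) : weight N r (-ξ) = weight N r ξ := by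
  simp [weight]

theorem reflect_solMul (hs : (N : ℝ) / 2 + 3 < s) (f : L2 N) :
    reflect N (solMul hs f) = solMul hs (reflect N f) :=
  reflect_fourierMul _ (fun ξ => by simp [besselSymbol, weight_neg]) f

theorem reflect_lapMul (hs : (N : ℝ) / 2 + 3 < s) (f : L2 N) :
    reflect N (lapMul hs f) = lapMul hs (reflect N f) :=
  reflect_fourierMul _ (fun ξ => by simp [laplacianSymbol, weight_neg]) f

/-- Both symbols are real, so on the Fourier side the integrand is real. After multiplication by
`-i`, the Laplacian drops out of the energy estimate. -/
theorem im_inner_solMul_lapMul (hs : (N : ℝ) / 2 + 3 < s) (f : L2 N) :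
    (inner ℂ (solMul hs f) (lapMul hs f)).im = 0 := by
  rw [← Lp.inner_fourier_eq, L2.inner_def]
  have : (fun ξ => inner ℂ ((𝓕 (solMul hs f) : L2 N) ξ) ((𝓕 (lapMul hs f) : L2 N) ξ))
      =ᵐ[volume] fun ξ => ((weight N s ξ * (-(2 * Real.pi) ^ 2 * (‖ξ‖ ^ 2 * weight N s ξ)) *
        ‖(𝓕 f : L2 N) ξ‖ ^ 2 : ℝ) : ℂ) := by
    filter_upwards [fourier_fourierMul_ae_eq _ (memLp_top_besselSymbol hs) f,
      fourier_fourierMul_ae_eq _ (memLp_top_laplacianSymbol hs) f] with ξ h1 h2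
    rw [solMul, lapMul, h1, h2, RCLike.inner_apply, map_mul, besselSymbol, laplacianSymbol,
      Complex.conj_ofReal]
    push_cast
    rw [← Complex.mul_conj' ((𝓕 f : L2 N) ξ)]
    ring
  rw [integral_congr_ae this, integral_complex_ofReal, Complex.ofReal_im]

/-- As the nonlinearity `F` is odd, `F(a) + F(b) = F(a) - F(-b)`, and the Lipschitz bound applies.
-/
theorem norm_nonlin_add_reflect_le (hα0 : 0 < α) (hα1 : α < 1) (lam : ℂ)
    (hs : (N : ℝ) / 2 + 3 < s) {M : ℝ} {v : L2 N} (hv : ‖solEval hs v‖ ≤ M) :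
    ‖(memLp_nonlin hα0 lam hs v).toLp _ + reflect N ((memLp_nonlin hα0 lam hs v).toLp _)‖ ≤
      2 * ‖lam‖ * M ^ α * ‖solMul hs v + reflect N (solMul hs v)‖ := by
  apply Lp.norm_le_mul_norm_of_ae_le_mul
  filter_upwards [Lp.coeFn_add ((memLp_nonlin hα0 lam hs v).toLp _)
    (reflect N ((memLp_nonlin hα0 lam hs v).toLp _)), (memLp_nonlin hα0 lam hs v).coeFn_toLp,
    reflect_ae_eq (memLp_nonlin hα0 lam hs v).coeFn_toLp,
    Lp.coeFn_add (solMul hs v) (reflect N (solMul hs v)), solMul_ae_eq hs v,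
    reflect_ae_eq (solMul_ae_eq hs v)] with x h1 h2 h3 h4 h5 h6
  rw [h1, h4, Pi.add_apply, Pi.add_apply, h2, h3, h5, h6]
  have := norm_nonlin_sub_le hα0 hα1 lam (((solEval hs v).norm_coe_le_norm x).trans hv)
    (b := -(solEval hs v (-x)))
    (by rw [norm_neg]; exact ((solEval hs v).norm_coe_le_norm (-x)).trans hv)
  simpa only [nonlin_neg, sub_neg_eq_add] using this

/-- The energy estimate for the even part of a solution. -/
theorem norm_inner_add_inner_le (hα0 : 0 < α) (hα1 : α < 1) (lam : ℂ)
    (hs : (N : ℝ) / 2 + 3 < s) {M : ℝ} {v : L2 N} (hv : ‖solEval hs v‖ ≤ M) {w : L2 N}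
    (hw : w = solMul hs v + reflect N (solMul hs v)) {w' : L2 N}
    (hw' : w' = -Complex.I • (rhs hα0 lam hs v + reflect N (rhs hα0 lam hs v))) :
    ‖inner ℂ w w' + inner ℂ w' w‖ ≤ 2 * (2 * ‖lam‖ * M ^ α) * ‖inner ℂ w w‖ := by
  set G : L2 N := (memLp_nonlin hα0 lam hs v).toLp _
  have e1 : w' = -Complex.I • lapMul hs (v + reflect N v) - Complex.I • (G + reflect N G) := by
    rw [hw', rhs, map_add, map_add, reflect_lapMul]
    module
  have e2 : w = solMul hs (v + reflect N v) := by rw [hw, map_add, reflect_solMul]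
  have e3 : inner ℂ w w' + inner ℂ w' w = ((2 * (inner ℂ w w').re : ℝ) : ℂ) := by
    rw [← inner_conj_symm w' w, Complex.add_conj]
  have e4 : (inner ℂ w (-Complex.I • lapMul hs (v + reflect N v))).re = 0 := by
    rw [inner_smul_right, e2, Complex.mul_re, im_inner_solMul_lapMul]
    simp
  have e5 : |(inner ℂ w (Complex.I • (G + reflect N G))).re| ≤
      ‖w‖ * (2 * ‖lam‖ * M ^ α * ‖w‖) := by
    refine (Complex.abs_re_le_norm _).trans ((norm_inner_le_norm _ _).trans ?_)
    rw [norm_smul, Complex.norm_I, one_mul]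
    gcongr
    rw [hw]
    exact norm_nonlin_add_reflect_le hα0 hα1 lam hs hv
  rw [e3, Complex.norm_real, Real.norm_eq_abs, abs_mul, abs_two, inner_self_eq_norm_sq_to_K, e1,
    inner_sub_right, Complex.sub_re, e4, zero_sub, abs_neg]
  have : ‖((‖w‖ : ℝ) : ℂ) ^ 2‖ = ‖w‖ ^ 2 := by
    rw [norm_pow, Complex.norm_real, norm_norm]
  calc _ ≤ 2 * (‖w‖ * (2 * ‖lam‖ * M ^ α * ‖w‖)) := by gcongr
    _ = 2 * (2 * ‖lam‖ * M ^ α) * ‖w‖ ^ 2 := by ring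
    _ = _ := by rw [← this]; rfl

/-- Solutions with odd initial value stay odd. -/
theorem SolvesEquation.solMul_add_reflect_eq_zero (hα0 : 0 < α) (hα1 : α < 1)
    (hs : (N : ℝ) / 2 + 3 < s)
    (hT : 0 < T) {u : ℝ → L2 N} (hu : SolvesEquation N α lam T u) {v : ℝ → L2 N}
    (hv : Continuous v) (huv : ∀ t ∈ Set.Icc 0 T, u t = solMul hs (v t))
    (h0 : solMul hs (v 0) + reflect N (solMul hs (v 0)) = 0) {t : ℝ} (ht : t ∈ Set.Icc 0 T) :
    solMul hs (v t) + reflect N (solMul hs (v t)) = 0 := by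
  have hc : Continuous fun τ => rhs hα0 lam hs (v τ) := (continuous_rhs hα0 hα1 lam hs).comp hv
  set A : L2 N →L[ℂ] L2 N :=
    ContinuousLinearMap.id ℂ (L2 N) + (reflect N).toContinuousLinearMap with hA
  have hAapp : ∀ f, A f = f + reflect N f := fun f => rfl
  -- Twice the even part of `u`, written through the integrated equation so that it is
  -- differentiable at every real `t`; the two agree on `[0,T]`.
  let w : ℝ → L2 N := fun t =>
    A (solMul hs (v 0)) - Complex.I • A (∫ τ in (0 : ℝ)..t, rhs hα0 lam hs (v τ))
  have hw : ∀ t ∈ Set.Icc 0 T, w t = A (solMul hs (v t)) := fun t ht => by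
    have := hu.solMul_sub_eq hα0 hα1 hs hT hv huv ht
    simp only [w]
    rw [← this, map_smul, smul_smul, Complex.I_mul_I, map_sub]
    module
  have hd : ∀ t, HasDerivAt w (-Complex.I • A (rhs hα0 lam hs (v t))) t := fun t => by
    have h1 : HasDerivAt (fun t => ∫ τ in (0 : ℝ)..t, rhs hα0 lam hs (v τ))
        (rhs hα0 lam hs (v t)) t :=
      intervalIntegral.integral_hasDerivAt_right (hc.intervalIntegrable _ _)
        (hc.stronglyMeasurableAtFilter _ _) hc.continuousAt
    have h2 := ((A.restrictScalars ℝ).hasFDerivAt.comp_hasDerivAt t h1).const_smul Complex.I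
    have h3 := h2.const_sub (A (solMul hs (v 0)))
    rw [neg_smul]
    exact h3
  obtain ⟨M, hM⟩ := isCompact_Icc.exists_bound_of_continuousOn (s := Set.Icc 0 T)
    (f := fun t => solEval hs (v t)) (by fun_prop)
  have hf : ∀ t, HasDerivAt (fun t => inner ℂ (w t) (w t)) _ t := fun t => (hd t).inner ℂ (hd t)
  -- Grönwall for the complex-valued `⟨w, w⟩`, with zero initial value and no source term, forces it
  -- to vanish.
  have hg := norm_le_gronwallBound_of_norm_deriv_right_le (a := 0) (b := T) (δ := 0)
    (K := 2 * (2 * ‖lam‖ * M ^ α)) (ε := 0)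
    (fun t _ => (hf t).continuousAt.continuousWithinAt) (fun t _ => (hf t).hasDerivWithinAt)
    (by
      rw [hw 0 ⟨le_rfl, hT.le⟩, hAapp, h0]
      simp)
    (fun t ht => by
      rw [add_zero]
      have ht' : t ∈ Set.Icc 0 T := ⟨ht.1, ht.2.le⟩
      exact norm_inner_add_inner_le hα0 hα1 lam hs (hM t ht') (by rw [hw t ht', hAapp])
        (by rw [hAapp])) t ht
  rw [gronwallBound_ε0_δ0] at hg
  have : w t = 0 := inner_self_eq_zero.1 (norm_le_zero_iff.1 hg)
  rwa [hw t ht, hAapp] at this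

/-- Continuity upgrades oddness almost everywhere to oddness everywhere, which allows evaluation at
the origin. -/
theorem solMul_add_reflect_eq_zero_iff (hs : (N : ℝ) / 2 + 3 < s) (v : L2 N) :
    solMul hs v + reflect N (solMul hs v) = 0 ↔ ∀ x, solEval hs v x + solEval hs v (-x) = 0 := by
  have hc : Continuous fun x => solEval hs v x + solEval hs v (-x) := by fun_prop
  have h : (solMul hs v + reflect N (solMul hs v) : L2 N) =ᵐ[volume]
      fun x => solEval hs v x + solEval hs v (-x) := by
    filter_upwards [Lp.coeFn_add (solMul hs v) (reflect N (solMul hs v)), solMul_ae_eq hs v,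
      reflect_ae_eq (solMul_ae_eq hs v)] with x h1 h2 h3
    rw [h1, Pi.add_apply, h2, h3]
  rw [Lp.eq_zero_iff_ae_eq_zero]
  constructor
  · intro h0
    exact congrFun ((hc.ae_eq_iff_eq volume continuous_zero).1 (h.symm.trans h0))
  · intro h0
    exact h.trans (Eventually.of_forall h0)

end

/-! ### The second-difference contradiction and the initial value -/

section

variable {N : ℕ} {s α T : ℝ} {lam : ℂ}

theorem nonlin_ofReal {h : ℝ} (hh : 0 ≤ h) : nonlin α lam h = lam * ((h ^ α * h : ℝ) : ℂ) := by
  rw [nonlin, Complex.norm_real, Real.norm_of_nonneg hh]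
  push_cast; ring

/-- Both arguments lie in the disc of radius `2h`, where the Lipschitz constant is at most `4|λ|h^α`
because `2^α ≤ 2`. -/
theorem norm_nonlin_sub_ofReal_le (hα0 : 0 < α) (hα1 : α < 1) {ε h : ℝ} (hh : 0 < h) (hε : ε ≤ 1)
    {a : ℂ} (ha : ‖a - h‖ ≤ ε * h) :
    ‖nonlin α lam a - lam * ((h ^ α * h : ℝ) : ℂ)‖ ≤ 4 * ε * ‖lam‖ * (h ^ α * h) := by
  have hε0 : 0 ≤ ε := nonneg_of_mul_nonneg_left ((norm_nonneg _).trans ha) hh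
  have hn : ‖(h : ℂ)‖ = h := by rw [Complex.norm_real, Real.norm_of_nonneg hh.le]
  have ha2 : ‖a‖ ≤ 2 * h := by
    have := norm_le_norm_add_norm_sub' a (h : ℂ)
    rw [hn] at this
    nlinarith
  rw [← nonlin_ofReal hh.le]
  have h2 : (2 : ℝ) ^ α ≤ 2 := by
    simpa using Real.rpow_le_rpow_of_exponent_le one_le_two hα1.le
  calc _ ≤ 2 * ‖lam‖ * (2 * h) ^ α * ‖a - h‖ :=
        norm_nonlin_sub_le hα0 hα1 lam ha2 (by rw [hn]; linarith)
    _ ≤ 2 * ‖lam‖ * (2 * h ^ α) * (ε * h) := by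
        rw [Real.mul_rpow zero_le_two hh.le]
        gcongr
    _ = _ := by ring

theorem rpow_one_add_sub_two_pos (hα0 : 0 < α) : 0 < (2 : ℝ) ^ (1 + α) - 2 := by
  have := Real.rpow_lt_rpow_of_exponent_lt (x := 2) one_lt_two (show (1 : ℝ) < 1 + α by linarith)
  rw [Real.rpow_one] at this
  linarith

theorem rpow_one_add_le_four (hα1 : α < 1) : (2 : ℝ) ^ (1 + α) ≤ 4 := by
  have := Real.rpow_le_rpow_of_exponent_le (x := 2) one_le_two (show 1 + α ≤ (2 : ℝ) by linarith)
  rw [Real.rpow_two] at this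
  linarith

/-- Second differences of `λ|z|^α z` along an almost linear function are of size `h^(1+α)`. -/
theorem norm_second_diff_nonlin_sub_le (hα0 : 0 < α) (hα1 : α < 1) {h : ℝ} (hh : 0 < h) {a b : ℂ}
    (ha : ‖a - h‖ ≤ ((2 : ℝ) ^ (1 + α) - 2) / 48 * h)
    (hb : ‖b - (2 * h : ℝ)‖ ≤ ((2 : ℝ) ^ (1 + α) - 2) / 48 * (2 * h)) :
    ‖nonlin α lam b - 2 * nonlin α lam a - lam * ((((2 : ℝ) ^ (1 + α) - 2) * (h ^ α * h) : ℝ) : ℂ)‖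
      ≤ ((2 : ℝ) ^ (1 + α) - 2) / 2 * (‖lam‖ * (h ^ α * h)) := by
  have hc0 := rpow_one_add_sub_two_pos hα0
  have hc4 := rpow_one_add_le_four hα1
  have h2α : (2 : ℝ) ^ (1 + α) = 2 * 2 ^ α := by rw [Real.rpow_add two_pos, Real.rpow_one]
  set c := (2 : ℝ) ^ (1 + α) - 2 with hc
  have h1 := norm_nonlin_sub_ofReal_le (lam := lam) hα0 hα1 hh (by linarith) ha
  have h2 := norm_nonlin_sub_ofReal_le (lam := lam) hα0 hα1 (by linarith : 0 < 2 * h)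
    (by linarith) hb
  have hpow : (2 * h) ^ α * (2 * h) = (c + 2) * (h ^ α * h) := by
    rw [Real.mul_rpow zero_le_two hh.le, hc, h2α]; ring
  rw [hpow] at h2
  have e : nonlin α lam b - 2 * nonlin α lam a - lam * ((c * (h ^ α * h) : ℝ) : ℂ) =
      (nonlin α lam b - lam * (((c + 2) * (h ^ α * h) : ℝ) : ℂ)) -
        2 * (nonlin α lam a - lam * ((h ^ α * h : ℝ) : ℂ)) := by
    push_cast; ring
  rw [e]
  refine (norm_sub_le _ _).trans ?_
  rw [norm_mul, Complex.norm_ofNat]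
  have hP : 0 ≤ ‖lam‖ * (h ^ α * h) := by positivity
  -- Since `c ≤ 2`, the factor `1/48` makes the total error at most half of the main term.
  calc _ ≤ 4 * (c / 48) * ‖lam‖ * ((c + 2) * (h ^ α * h)) +
        2 * (4 * (c / 48) * ‖lam‖ * (h ^ α * h)) := by gcongr
    _ = c / 12 * (c + 4) * (‖lam‖ * (h ^ α * h)) := by ring
    _ ≤ c / 12 * 6 * (‖lam‖ * (h ^ α * h)) := by gcongr; linarith
    _ = _ := by ring

/-- A solution that vanishes at the origin and is initially linear along a line through the origin
cannot be regular. -/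
theorem not_forall_solEval_sub_eq (hα0 : 0 < α) (hα1 : α < 1) (hlam : lam ≠ 0)
    (hs : (N : ℝ) / 2 + 3 < s) (hsα : (N : ℝ) / 2 + 3 + α < s) (hT : 0 < T) {v : ℝ → L2 N}
    (hv : Continuous v) (hv0 : ∀ t ∈ Set.Icc 0 T, solEval hs (v t) 0 = 0) (e : Space N)
    (he : ‖e‖ = 1) (hφ : ∀ h : ℝ, 0 < h → h ≤ 1 → solEval hs (v 0) (h • e) = h) :
    ¬ ∀ t ∈ Set.Icc 0 T, ∀ x, Complex.I * (solEval hs (v t) x - solEval hs (v 0) x) =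
      ∫ τ in (0 : ℝ)..t, rhsEval α lam hs (v τ) x := by
  intro hsol
  -- `β > α` beats the nonlinearity, `β ≤ 1` keeps the order `1 + β` within second differences, and
  -- `N/2 + 3 + β < s` leaves enough decay after the Laplacian has used two units.
  obtain ⟨β, hβ, hβ1, hsβ⟩ : ∃ β, α < β ∧ β ≤ 1 ∧ (N : ℝ) / 2 + 3 + β < s := by
    obtain ⟨β, h1, h2⟩ := exists_between (lt_min hα1 (show α < s - (N / 2 + 3) by linarith))
    exact ⟨β, h1, (h2.trans_le (min_le_left _ _)).le, by
      linarith [h2.trans_le (min_le_right (1 : ℝ) (s - ((N : ℝ) / 2 + 3)))]⟩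
  obtain ⟨K₁, hK₁, hS⟩ := norm_fourierEval_second_diff_le (memLp_two_besselSymbol hs) (b := 1 + β)
    zero_le_one (by linarith) (by linarith) (by linarith) (norm_besselSymbol_le s)
  obtain ⟨K₂, hK₂, hL⟩ := norm_fourierEval_second_diff_le (memLp_two_laplacianSymbol hs)
    (b := 1 + β) (by positivity) (by linarith) (by linarith) (by linarith)
    (norm_laplacianSymbol_le s)
  obtain ⟨K₃, hLip⟩ := norm_fourierEval_sub_le (memLp_two_besselSymbol hs) zero_le_one
    (by linarith) (norm_besselSymbol_le s)
  obtain ⟨B, hB⟩ := isCompact_Icc.exists_bound_of_continuousOn (s := Set.Icc 0 T) hv.continuousOn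
  have hc0 := rpow_one_add_sub_two_pos hα0
  set c := (2 : ℝ) ^ (1 + α) - 2 with hc
  -- The time `t₀` is fixed before `h`: the Lipschitz bound at the origin makes the relative error
  -- uniform in `h`.
  obtain ⟨t₀, ht₀, ht₀T, hclose⟩ : ∃ t₀, 0 < t₀ ∧ t₀ ≤ T ∧
      ∀ τ ∈ Set.Icc 0 t₀, K₃ * ‖v τ - v 0‖ ≤ c / 48 := by
    have h1 : Tendsto (fun τ => K₃ * ‖v τ - v 0‖) (𝓝 0) (𝓝 0) := by
      have : Continuous fun τ => K₃ * ‖v τ - v 0‖ := by fun_prop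
      simpa using this.tendsto 0
    obtain ⟨δ, hδ, h2⟩ := Metric.eventually_nhds_iff.1
      (h1.eventually (eventually_lt_nhds (show (0 : ℝ) < c / 48 by positivity)))
    refine ⟨min T (δ / 2), by positivity, min_le_left _ _, fun τ hτ => (h2 ?_).le⟩
    rw [Real.dist_eq, sub_zero, abs_of_nonneg hτ.1]
    linarith [hτ.2.trans (min_le_right _ _)]
  have ht₀mem : t₀ ∈ Set.Icc 0 T := ⟨ht₀.le, ht₀T⟩
  have h0mem : (0 : ℝ) ∈ Set.Icc 0 T := ⟨le_rfl, hT.le⟩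
  have hB0 : 0 ≤ B := (norm_nonneg _).trans (hB 0 h0mem)
  have hlin : ∀ h : ℝ, 0 < h → h ≤ 1 → ∀ τ ∈ Set.Icc 0 t₀,
      ‖solEval hs (v τ) (h • e) - h‖ ≤ c / 48 * h := fun h hh hh1 τ hτ => by
    have := hLip (h • e) (v τ - v 0)
    change ‖solEval hs (v τ - v 0) (h • e) - solEval hs (v τ - v 0) 0‖ ≤ _ at this
    rw [map_sub, BoundedContinuousFunction.sub_apply,
      BoundedContinuousFunction.sub_apply, hv0 τ ⟨hτ.1, hτ.2.trans ht₀T⟩, hv0 0 h0mem,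
      hφ h hh hh1, sub_zero, sub_zero, norm_smul, he, Real.norm_of_nonneg hh.le, mul_one] at this
    calc _ ≤ K₃ * h * ‖v τ - v 0‖ := this
      _ = K₃ * ‖v τ - v 0‖ * h := by ring
      _ ≤ _ := by gcongr; exact hclose τ hτ
  -- The restriction `h ≤ 1/2` keeps both `h` and `2h` in the range where the initial value is
  -- linear.
  have hbound : ∀ h : ℝ, 0 < h → h ≤ 1 / 2 →
      t₀ * (c / 2) * ‖lam‖ ≤ (2 * K₁ * B + t₀ * (K₂ * B)) * h ^ (β - α) := fun h hh hh2 => by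
    -- No third term appears because `u(τ,0) = 0` and the nonlinearity vanishes there.
    let D : ℝ → ℂ := fun τ => nonlin α lam (solEval hs (v τ) ((2 * h) • e)) -
      2 * nonlin α lam (solEval hs (v τ) (h • e))
    let L : ℝ → ℂ := fun τ => lapEval hs (v τ) ((2 * h) • e) - 2 * lapEval hs (v τ) (h • e) +
      lapEval hs (v τ) 0
    have hnl := continuous_nonlin hα0 lam
    have hDc : Continuous D := by fun_prop
    have hLc : Continuous L := by fun_prop
    have hRc : ∀ x, Continuous fun τ => rhsEval α lam hs (v τ) x := fun x => by
      unfold rhsEval; fun_prop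
    have hdouble : (2 * h) • e = (2 : ℝ) • h • e := by rw [smul_smul]
    have hnorm : ‖h • e‖ = h := by rw [norm_smul, he, mul_one, Real.norm_of_nonneg hh.le]
    have hsum : (∫ τ in (0 : ℝ)..t₀, D τ) =
        Complex.I * (solEval hs (v t₀) ((2 * h) • e) - 2 * solEval hs (v t₀) (h • e) +
          solEval hs (v t₀) 0) -
        Complex.I * (solEval hs (v 0) ((2 * h) • e) - 2 * solEval hs (v 0) (h • e) +
          solEval hs (v 0) 0) - ∫ τ in (0 : ℝ)..t₀, L τ := by
      have e1 := hsol t₀ ht₀mem ((2 * h) • e)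
      have e2 := hsol t₀ ht₀mem (h • e)
      have e3 := hsol t₀ ht₀mem 0
      have e4 : (∫ τ in (0 : ℝ)..t₀, D τ) + (∫ τ in (0 : ℝ)..t₀, L τ) =
          (∫ τ in (0 : ℝ)..t₀, rhsEval α lam hs (v τ) ((2 * h) • e)) -
          2 * (∫ τ in (0 : ℝ)..t₀, rhsEval α lam hs (v τ) (h • e)) +
          ∫ τ in (0 : ℝ)..t₀, rhsEval α lam hs (v τ) 0 := by
        have i2 := ((hRc (h • e)).intervalIntegrable (μ := volume) 0 t₀).const_mul 2
        rw [← intervalIntegral.integral_const_mul,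
          ← intervalIntegral.integral_sub ((hRc _).intervalIntegrable _ _) i2,
          ← intervalIntegral.integral_add (((hRc _).intervalIntegrable _ _).sub i2)
            ((hRc _).intervalIntegrable _ _),
          ← intervalIntegral.integral_add (hDc.intervalIntegrable _ _)
            (hLc.intervalIntegrable _ _)]
        refine intervalIntegral.integral_congr fun τ hτ => ?_
        rw [Set.uIcc_of_le ht₀.le] at hτ
        simp only [D, L, rhsEval, hv0 τ ⟨hτ.1, hτ.2.trans ht₀T⟩, nonlin_zero]
        ring
      rw [← e1, ← e2, ← e3] at e4
      linear_combination e4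
    have hupper : ‖∫ τ in (0 : ℝ)..t₀, D τ‖ ≤
        (2 * K₁ * B + t₀ * (K₂ * B)) * h ^ (1 + β) := by
      have hSol : ∀ t ∈ Set.Icc 0 T, ‖Complex.I * (solEval hs (v t) ((2 * h) • e) -
          2 * solEval hs (v t) (h • e) + solEval hs (v t) 0)‖ ≤ K₁ * B * h ^ (1 + β) :=
        fun t ht => by
          rw [norm_mul, Complex.norm_I, one_mul, hdouble]
          refine (hS (h • e) (v t)).trans ?_
          rw [hnorm, mul_right_comm]
          gcongr
          exact hB t ht
      have hLap : ‖∫ τ in (0 : ℝ)..t₀, L τ‖ ≤ K₂ * B * h ^ (1 + β) * |t₀ - 0| := by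
        refine intervalIntegral.norm_integral_le_of_norm_le_const fun τ hτ => ?_
        rw [Set.uIoc_of_le ht₀.le] at hτ
        simp only [L, hdouble]
        refine (hL (h • e) (v τ)).trans ?_
        rw [hnorm, mul_right_comm]
        gcongr
        exact hB τ ⟨hτ.1.le, hτ.2.trans ht₀T⟩
      rw [sub_zero, abs_of_pos ht₀] at hLap
      rw [hsum]
      refine (norm_sub_le _ _).trans ((add_le_add ((norm_sub_le _ _).trans
        (add_le_add (hSol t₀ ht₀mem) (hSol 0 h0mem))) hLap).trans_eq ?_)
      ring
    have hlower : t₀ * (c / 2) * ‖lam‖ * (h ^ α * h) ≤ ‖∫ τ in (0 : ℝ)..t₀, D τ‖ := by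
      have h1 : ‖∫ τ in (0 : ℝ)..t₀, (D τ - lam * ((c * (h ^ α * h) : ℝ) : ℂ))‖ ≤
          c / 2 * (‖lam‖ * (h ^ α * h)) * |t₀ - 0| := by
        refine intervalIntegral.norm_integral_le_of_norm_le_const fun τ hτ => ?_
        rw [Set.uIoc_of_le ht₀.le] at hτ
        have hτ' : τ ∈ Set.Icc 0 t₀ := ⟨hτ.1.le, hτ.2⟩
        exact norm_second_diff_nonlin_sub_le hα0 hα1 hh (hlin h hh (by linarith) τ hτ')
          (hlin (2 * h) (by linarith) (by linarith) τ hτ')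
      rw [intervalIntegral.integral_sub (hDc.intervalIntegrable _ _)
        (by simp), intervalIntegral.integral_const,
        sub_zero, abs_of_pos ht₀] at h1
      have h2 : ‖t₀ • (lam * ((c * (h ^ α * h) : ℝ) : ℂ))‖ = t₀ * (‖lam‖ * (c * (h ^ α * h))) := by
        rw [norm_smul, norm_mul, Complex.norm_real, Real.norm_of_nonneg ht₀.le,
          Real.norm_of_nonneg (by positivity)]
      have h3 := norm_sub_norm_le (t₀ • (lam * ((c * (h ^ α * h) : ℝ) : ℂ)))
        (∫ τ in (0 : ℝ)..t₀, D τ)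
      rw [norm_sub_rev, h2] at h3
      linarith
    have hsplit : h ^ (1 + β) = h ^ (β - α) * (h ^ α * h) := by
      rw [← Real.rpow_add_one hh.ne', ← Real.rpow_add hh]
      ring_nf
    have := hlower.trans hupper
    rw [hsplit, ← mul_assoc (2 * K₁ * B + t₀ * (K₂ * B))] at this
    exact le_of_mul_le_mul_right this (by positivity)
  -- As `β > α`, the upper bound tends to zero while the lower bound does not depend on `h`.
  have hlim : Tendsto (fun h : ℝ => (2 * K₁ * B + t₀ * (K₂ * B)) * h ^ (β - α)) (𝓝[>] 0) (𝓝 0) := by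
    have : Continuous fun h : ℝ => (2 * K₁ * B + t₀ * (K₂ * B)) * h ^ (β - α) :=
      continuous_const.mul (Real.continuous_rpow_const (by linarith))
    have h2 := this.tendsto 0
    rw [Real.zero_rpow (by linarith), mul_zero] at h2
    exact h2.mono_left nhdsWithin_le_nhds
  have hle : t₀ * (c / 2) * ‖lam‖ ≤ 0 := by
    refine ge_of_tendsto hlim ?_
    filter_upwards [Ioc_mem_nhdsGT (show (0 : ℝ) < 1 / 2 by norm_num)] with h hh
    exact hbound h hh.1 hh.2
  have hpos : 0 < t₀ * (c / 2) * ‖lam‖ := by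
    have := norm_pos_iff.2 hlam
    positivity
  linarith

/-- A compactly supported smooth function, equal to the `i`-th coordinate on the unit ball. -/
noncomputable def cutoffCoord (i : Fin N) (x : Space N) : ℂ :=
  ((x i * (⟨1, 2, one_pos, one_lt_two⟩ : ContDiffBump (0 : Space N)) x : ℝ) : ℂ)

theorem contDiff_cutoffCoord (i : Fin N) : ContDiff ℝ ∞ (cutoffCoord i) :=
  Complex.ofRealCLM.contDiff.comp
    ((EuclideanSpace.proj (𝕜 := ℝ) i).contDiff.mul (ContDiffBump.contDiff _))

theorem hasCompactSupport_cutoffCoord (i : Fin N) : HasCompactSupport (cutoffCoord i) :=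
  ((ContDiffBump.hasCompactSupport _).mul_left).comp_left (g := Complex.ofReal) rfl

theorem cutoffCoord_neg (i : Fin N) (x : Space N) : cutoffCoord i (-x) = -cutoffCoord i x := by
  simp [cutoffCoord, ContDiffBump.neg]

theorem cutoffCoord_smul_single (i : Fin N) {h : ℝ} (h0 : 0 < h) (h1 : h ≤ 1) :
    cutoffCoord i (h • EuclideanSpace.single i (1 : ℝ)) = h := by
  have : (⟨1, 2, one_pos, one_lt_two⟩ : ContDiffBump (0 : Space N))
      (h • EuclideanSpace.single i (1 : ℝ)) = 1 := by
    apply ContDiffBump.one_of_mem_closedBall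
    simp [norm_smul, abs_of_pos h0, h1]
  rw [cutoffCoord, this]
  simp

end

end NLS

theorem theorem1p3 (N : ℕ) (hN : 1 ≤ N) (α : ℝ) (hα0 : 0 < α) (hα1 : α < 1)
    (lam : ℂ) (hlam : lam ≠ 0) (s : ℝ) (hs : 3 + (N : ℝ) / 2 + α < s) :
    ∃ φ : NLS.Space N → ℂ, ContDiff ℝ ∞ φ ∧ HasCompactSupport φ ∧
      ¬ ∃ T : ℝ, 0 < T ∧ ∃ u : ℝ → NLS.L2 N, NLS.IsSolution N α lam s T φ u := by
  -- Any coordinate would do; `N ≥ 1` provides one.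
  let i : Fin N := ⟨0, hN⟩
  refine ⟨NLS.cutoffCoord i, NLS.contDiff_cutoffCoord i, NLS.hasCompactSupport_cutoffCoord i, ?_⟩
  rintro ⟨T, hT, u, hu⟩
  have hs' : (N : ℝ) / 2 + 3 < s := by linarith
  obtain ⟨v, hv, huv⟩ := hu.continuous_sobolev.exists_profile hs' hT
  have h0 : (0 : ℝ) ∈ Set.Icc 0 T := ⟨le_rfl, hT.le⟩
  have hinit : ∀ x, NLS.solEval hs' (v 0) x = NLS.cutoffCoord i x := by
    rw [← funext_iff, ← (NLS.solEval hs' (v 0)).continuous.ae_eq_iff_eq volume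
      (NLS.contDiff_cutoffCoord i).continuous]
    refine (NLS.solMul_ae_eq hs' (v 0)).symm.trans ?_
    rw [← huv 0 h0]
    exact hu.initial
  have hodd : ∀ t ∈ Set.Icc 0 T, NLS.solEval hs' (v t) 0 = 0 := fun t ht => by
    have := hu.equation.solMul_add_reflect_eq_zero hα0 hα1 hs' hT hv huv
      ((NLS.solMul_add_reflect_eq_zero_iff hs' (v 0)).2 fun x => by
        rw [hinit, hinit, NLS.cutoffCoord_neg, add_neg_cancel]) ht
    have := (NLS.solMul_add_reflect_eq_zero_iff hs' (v t)).1 this 0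
    rwa [neg_zero, add_self_eq_zero] at this
  exact NLS.not_forall_solEval_sub_eq hα0 hα1 hlam hs' (by linarith) hT hv hodd
    (EuclideanSpace.single i (1 : ℝ)) (by simp)
    (fun h h0 h1 => by rw [hinit, NLS.cutoffCoord_smul_single i h0 h1])
    fun t ht x => hu.equation.solEval_sub_eq hα0 hα1 hs' hT hv huv ht x
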